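/- **Theorem.** Let $\nu$ be a positive integer, $L$ a non-negative integer and $q$ a complex number with $|q|<1$. For non-negative integers $n_1,\dots,n_\nu$ put $N_k=n_k+n_{k+1}+\cdots+n_\nu$ for $1\le k\le\nu$. Then $$\sum_{\substack{i,m,n_1,\dots,n_\nu\ge 0\\ i+m\equiv N_1+\cdots+N_\nu\ (\mathrm{mod}\ 2)}} q^{\frac{m^2+3(i^2+N_1^2+\cdots+N_\nu^2)}{2}}{L-N_1\brack i}_{q^3}{3n_\nu\brack m}_{q}{2n_\nu+\frac{i-N_1-\cdots-N_\nu-m}{2}\brack 2n_\nu}_{q^3}\prod_{j=1}^{\nu-1}{i-\sum_{k=1}^{j}N_k+n_j\brack n_j}_{q^3}$$ $$=\sum_{j=-\infty}^{\infty}q^{3\binom{\nu+2}{2}j^2+j}\left(\begin{array}{c}L,\ (\nu+2)j\\ (\nu+2)j\end{array};q^3\right)_2,$$ where both sums converge. Here $(q;q)_n=\prod_{k=1}^{n}(1-q^k)$ for $n\ge0$, and $1/(q;q)_n=0$ for $n<0$. For integers $a,b$, the $q$-binomial coefficient is ${a\brack b}_q=\frac{(q;q)_a}{(q;q)_b(q;q)_{a-b}}$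 if $b\ge0$ and $a-b\ge0$, and ${a\brack b}_q=0$ otherwise. The Andrews--Baxter $q$-trinomial coefficient is $$\left(\begin{array}{c}L,\ b\\ a\end{array};q\right)_2=\sum_{n\ge0}q^{n(n+b)}\frac{(q;q)_L}{(q;q)_n(q;q)_{n+a}(q;q)_{L-2n-a}}.$$ -/

import Mathlib

/-- The `q`-Pochhammer symbol `(a; q)_n = (1 - a)(1 - a q) ⋯ (1 - a q^(n-1))` for `n ≥ 0`. -/
noncomputable def qPoch (a q : ℂ) (n : ℕ) : ℂ :=
  ∏ k ∈ Finset.range n, (1 - a * q ^ k)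

/-- The reciprocal `1 / (q; q)_n` for an integer `n`, with the convention that it is `0`
for `n < 0`. -/
noncomputable def qPochRecip (q : ℂ) (n : ℤ) : ℂ :=
  if 0 ≤ n then 1 / qPoch q q n.toNat else 0

/-- The `q`-binomial coefficient `[a choose b]_q`, for integers `a` and `b`. It equals
`(q; q)_a / ((q; q)_b (q; q)_(a-b))` if `b ≥ 0` and `a - b ≥ 0`, and `0` otherwise. -/
noncomputable def qBinom (q : ℂ) (a b : ℤ) : ℂ :=
  if 0 ≤ b ∧ 0 ≤ a - b then
    qPoch q q a.toNat / (qPoch q q b.toNat * qPoch q q (a - b).toNat)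
  else 0

/-- The Andrews-Baxter `q`-trinomial coefficient `(L, b; a; q)_2`. The summand vanishes
unless `0 ≤ n`, `0 ≤ n + a` and `2 n + a ≤ L`, so the sum has finitely many nonzero terms. -/
noncomputable def roundTrinomial (q : ℂ) (L : ℕ) (b a : ℤ) : ℂ :=
  ∑' n : ℕ, q ^ ((n : ℤ) * (n + b)) *
    (qPoch q q L * qPochRecip q n * qPochRecip q (n + a) * qPochRecip q (L - 2 * n - a))

/-- The entry `n_k` of a tuple `(n_1, …, n_ν)`, with `k` counted from `1`. -/
def entry {ν : ℕ} (n : Fin ν → ℕ) (k : ℕ) : ℕ :=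
  if h : 1 ≤ k ∧ k ≤ ν then n ⟨k - 1, by omega⟩ else 0

/-- The partial sum `N_k = n_k + n_(k+1) + ⋯ + n_ν`. -/
def tailSum {ν : ℕ} (n : Fin ν → ℕ) (k : ℕ) : ℕ :=
  ∑ j ∈ Finset.Icc k ν, entry n j

/-- The summand of the multisum, at `i`, `m` and `(n_1, …, n_ν)`. Under the parity condition
of the multisum both halves occurring here are integers. -/
noncomputable def multisumTerm (q : ℂ) (L ν i m : ℕ) (n : Fin ν → ℕ) : ℂ :=
  q ^ ((m ^ 2 + 3 * (i ^ 2 + ∑ k ∈ Finset.Icc 1 ν, tailSum n k ^ 2)) / 2) *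
    qBinom (q ^ 3) ((L : ℤ) - tailSum n 1) i *
    qBinom q (3 * entry n ν) m *
    qBinom (q ^ 3)
      (2 * entry n ν + ((i : ℤ) - (∑ k ∈ Finset.Icc 1 ν, (tailSum n k : ℤ)) - m) / 2)
      (2 * entry n ν) *
    ∏ j ∈ Finset.Icc 1 (ν - 1),
      qBinom (q ^ 3) ((i : ℤ) - (∑ k ∈ Finset.Icc 1 j, (tailSum n k : ℤ)) + entry n j) (entry n j)

/-- The index set of the multisum: all `(i, m, (n_1, …, n_ν))` of non-negative integers with
`i + m ≡ N_1 + ⋯ + N_ν (mod 2)`. -/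
def multisumIndex (ν : ℕ) : Set (ℕ × ℕ × (Fin ν → ℕ)) :=
  {x | x.1 + x.2.1 ≡ ∑ k ∈ Finset.Icc 1 ν, tailSum x.2.2 k [MOD 2]}

/-- The summand `q^(3 C(ν+2, 2) j² + j) (L, (ν+2) j; (ν+2) j; q³)_2` of the other side. -/
noncomputable def trinomialTerm (q : ℂ) (L ν : ℕ) (j : ℤ) : ℂ :=
  q ^ (3 * ((ν + 2).choose 2 : ℤ) * j ^ 2 + j) *
    roundTrinomial (q ^ 3) L ((ν + 2) * j) ((ν + 2) * j)

/-! ### Finite `q`-products, `q`-binomial coefficients and Pascal's rules. -/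

section QBinomial

/-! Write q = p² and P = p³, so that all half-integral exponents become integral. The engine is
Warnaar's refined `q`-trinomial T(K, M; a, b) in base P² (`refinedTrinomial`), through three facts.

Stability: Σ_i P^(i²) [L+M-i, L] T(L-i, i; a, b) = P^(b²) T(L, M; a+b, b), see
`refinedTrinomial_transform`.

Diagonal sum: Σ_M P^((L-M)²) T(L-M, M; a, b) is P^(a²) times the Andrews–Baxter trinomial with index
a+b, see `diagonalSum_eq`.

Seed: the sum over m in the multisum equals Σ_j q^j P^(j²) T(K, M; j, j). It comes from sorting the
factors of (-zp; p²)_(3M) by the residue of their index mod 3, and from the `q`-Pfaff–Saalschütz sum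
(`qBinomSum_three_mul`, `qBinomTripleSum_evenBinom`).

Applying the transform ν times to the seed moves a from j to (ν+1)j, and the diagonal sum then
produces the trinomial with index (ν+2)j. The exponent of P is (ν+1)j² + (ν+1)²j² = (ν+1)(ν+2)j²,
which is 3·C(ν+2, 2)·j² as an exponent of q. Unrolled, the iterated transform is the multisum: its
summation variables, from the outside in, are N_1, …, N_ν (`sum_chainWeight`).

Stability and the diagonal sum are proved by recurrences. These are read off the formal generating
function of `refinedSum` with weight u^(K-a) v^(K+a), which is (-p u v; p²)_M / ((u²; p²)_(A+1) (v²;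
p²)_(C+1)). -/

theorem qPoch_self_succ (q : ℂ) (n : ℕ) :
    qPoch q q (n + 1) = qPoch q q n * (1 - q ^ (n + 1)) := by
  rw [qPoch, Finset.prod_range_succ, ← qPoch, pow_succ']

theorem one_sub_pow_ne_zero {q : ℂ} (hq : ‖q‖ < 1) {n : ℕ} (hn : n ≠ 0) : 1 - q ^ n ≠ 0 := by
  intro h
  have h1 : ‖q ^ n‖ = 1 := by rw [← sub_eq_zero.mp h, norm_one]
  rw [norm_pow] at h1
  exact absurd h1 (pow_lt_one₀ (norm_nonneg _) hq hn).ne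

theorem one_sub_zpow_ne_zero {q : ℂ} (hq : ‖q‖ < 1) {n : ℤ} (hn : 0 < n) : 1 - q ^ n ≠ 0 := by
  lift n to ℕ using hn.le
  rw [zpow_natCast]
  exact one_sub_pow_ne_zero hq (by omega)

theorem qPoch_self_ne_zero {q : ℂ} (hq : ‖q‖ < 1) (n : ℕ) : qPoch q q n ≠ 0 := by
  induction n with
  | zero => simp [qPoch]
  | succ n ih =>
    rw [qPoch_self_succ]
    exact mul_ne_zero ih (one_sub_pow_ne_zero hq (by omega))

theorem qPoch_self_toNat (q : ℂ) {a : ℤ} (ha : 1 ≤ a) :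
    qPoch q q a.toNat = qPoch q q (a - 1).toNat * (1 - q ^ a) := by
  obtain ⟨n, rfl⟩ : ∃ n : ℕ, a = n + 1 := ⟨(a - 1).toNat, by omega⟩
  have h1 : ((n : ℤ) + 1).toNat = n + 1 := by omega
  have h2 : ((n : ℤ) + 1 - 1).toNat = n := by omega
  rw [h1, h2, qPoch_self_succ]
  norm_cast

theorem qPochRecip_of_neg (q : ℂ) {n : ℤ} (hn : n < 0) : qPochRecip q n = 0 := by
  rw [qPochRecip, if_neg (by omega)]

theorem qPochRecip_mul {q : ℂ} (hq : ‖q‖ < 1) (n : ℤ) :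
    qPochRecip q n * (1 - q ^ n) = qPochRecip q (n - 1) := by
  rcases lt_trichotomy n 0 with h | h | h
  · rw [qPochRecip_of_neg q h, qPochRecip_of_neg q (by omega), zero_mul]
  · subst h
    rw [qPochRecip_of_neg q (by omega : (0 : ℤ) - 1 < 0)]
    simp
  · rw [qPochRecip, qPochRecip, if_pos (by omega), if_pos (by omega), qPoch_self_toNat q h]
    have := one_sub_zpow_ne_zero hq h
    have := qPoch_self_ne_zero hq (n - 1).toNat
    field_simp

theorem qBinom_eq (q : ℂ) (a b : ℤ) :
    qBinom q a b = qPoch q q a.toNat * qPochRecip q b * qPochRecip q (a - b) := by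
  rw [qBinom, qPochRecip, qPochRecip]
  by_cases h1 : 0 ≤ b
  · by_cases h2 : 0 ≤ a - b
    · rw [if_pos ⟨h1, h2⟩, if_pos h1, if_pos h2]
      ring
    · rw [if_neg (by omega), if_neg h2, mul_zero]
  · rw [if_neg (by omega), if_neg h1, mul_zero, zero_mul]

theorem qBinom_symm (q : ℂ) (a b : ℤ) : qBinom q a b = qBinom q a (a - b) := by
  rw [qBinom_eq, qBinom_eq, sub_sub_cancel]
  ring

theorem qBinom_of_neg (q : ℂ) {a b : ℤ} (h : b < 0) : qBinom q a b = 0 := by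
  rw [qBinom, if_neg (by omega)]

theorem qBinom_of_lt (q : ℂ) {a b : ℤ} (h : a < b) : qBinom q a b = 0 := by
  rw [qBinom, if_neg (by omega)]

theorem qBinom_zero_right {q : ℂ} (hq : ‖q‖ < 1) {a : ℤ} (h : 0 ≤ a) : qBinom q a 0 = 1 := by
  rw [qBinom, if_pos (by omega), sub_zero, Int.toNat_zero]
  have := qPoch_self_ne_zero hq a.toNat
  rw [show qPoch q q 0 = 1 by simp [qPoch], one_mul, div_self this]

theorem qBinom_self {q : ℂ} (hq : ‖q‖ < 1) {a : ℤ} (h : 0 ≤ a) : qBinom q a a = 1 := by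
  rw [qBinom_symm, sub_self, qBinom_zero_right hq h]

/-- The point a = b = 0 is excluded because [0, 0] = 1 while both terms on the right vanish there.
Later uses must check that this point is harmless. -/
theorem qBinom_pascal {q : ℂ} (hq0 : q ≠ 0) (hq : ‖q‖ < 1) {a b : ℤ} (hab : a ≠ 0 ∨ b ≠ 0) :
    qBinom q a b = qBinom q (a - 1) b + q ^ (a - b) * qBinom q (a - 1) (b - 1) := by
  rcases lt_or_ge 0 a with h | h
  · rw [qBinom_eq, qBinom_eq q (a - 1) b, qBinom_eq q (a - 1) (b - 1),
      qPoch_self_toNat q (by omega : 1 ≤ a), ← qPochRecip_mul hq b,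
      show a - 1 - (b - 1) = a - b by ring, show a - 1 - b = a - b - 1 by ring,
      ← qPochRecip_mul hq (a - b)]
    have : q ^ a = q ^ (a - b) * q ^ b := by rw [← zpow_add₀ hq0]; congr 1; ring
    rw [this]
    ring
  · have h1 : qBinom q a b = 0 := by rw [qBinom, if_neg (by omega)]
    have h2 : qBinom q (a - 1) b = 0 := by rw [qBinom, if_neg (by omega)]
    have h3 : qBinom q (a - 1) (b - 1) = 0 := by rw [qBinom, if_neg (by omega)]
    rw [h1, h2, h3]; ring

theorem qBinom_pascal' {q : ℂ} (hq0 : q ≠ 0) (hq : ‖q‖ < 1) {a b : ℤ} (hab : a ≠ 0 ∨ b ≠ 0) :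
    qBinom q a b = q ^ b * qBinom q (a - 1) b + qBinom q (a - 1) (b - 1) := by
  rw [qBinom_symm, qBinom_pascal hq0 hq (by omega), qBinom_symm q (a - 1) b,
    qBinom_symm q (a - 1) (b - 1), show a - 1 - (b - 1) = a - b by ring,
    show a - 1 - b = a - b - 1 by ring, show a - (a - b) = b by ring]
  ring

theorem norm_sq_lt_one {p : ℂ} (hp : ‖p‖ < 1) : ‖p ^ 2‖ < 1 := by
  rw [norm_pow]; exact pow_lt_one₀ (norm_nonneg _) hp two_ne_zero

/-- The `q`-binomial theorem, in the form of a recurrence for the functionals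
`f ↦ Σ_n p^(n²) [M, n] f(n)`. -/
theorem sum_qBinom_succ {p : ℂ} (hp0 : p ≠ 0) (hp : ‖p‖ < 1) (M : ℕ) (f : ℕ → ℂ) :
    ∑ n ∈ Finset.range (M + 1 + 1), p ^ (n ^ 2) * qBinom (p ^ 2) (M + 1 : ℕ) n * f n =
      ∑ n ∈ Finset.range (M + 1), p ^ (n ^ 2) * qBinom (p ^ 2) M n * f n +
      p ^ (2 * M + 1) *
        ∑ n ∈ Finset.range (M + 1), p ^ (n ^ 2) * qBinom (p ^ 2) M n * f (n + 1) := by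
  have hq0 := pow_ne_zero 2 hp0
  have hq := norm_sq_lt_one hp
  have e1 : ∑ n ∈ Finset.range (M + 1), p ^ (n ^ 2) * qBinom (p ^ 2) M n * f n =
      ∑ n ∈ Finset.range (M + 1 + 1), p ^ (n ^ 2) * qBinom (p ^ 2) M n * f n := by
    rw [Finset.sum_range_succ _ (M + 1), qBinom_of_lt _ (by push_cast; omega)]
    ring
  have e2 : p ^ (2 * M + 1) *
        ∑ n ∈ Finset.range (M + 1), p ^ (n ^ 2) * qBinom (p ^ 2) M n * f (n + 1) =
      ∑ n ∈ Finset.range (M + 1 + 1), p ^ (n ^ 2) *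
        ((p ^ 2) ^ ((M : ℤ) + 1 - n) * qBinom (p ^ 2) M ((n : ℤ) - 1)) * f n := by
    rw [Finset.sum_range_succ' _ (M + 1), Finset.mul_sum,
      qBinom_of_neg _ (by simp : ((0 : ℕ) : ℤ) - 1 < 0)]
    simp only [mul_zero, zero_mul, add_zero]
    refine Finset.sum_congr rfl fun n hn => ?_
    have hn' := Finset.mem_range.mp hn
    obtain ⟨d, rfl⟩ : ∃ d, M = n + d := ⟨M - n, by omega⟩
    rw [show ((n + d : ℕ) : ℤ) + 1 - ((n + 1 : ℕ) : ℤ) = (d : ℕ) by push_cast; ring, zpow_natCast]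
    push_cast
    rw [add_sub_cancel_right]
    ring
  rw [e1, e2, ← Finset.sum_add_distrib]
  refine Finset.sum_congr rfl fun n _ => ?_
  push_cast
  rw [qBinom_pascal hq0 hq (a := (M : ℤ) + 1) (by omega), add_sub_cancel_right]
  ring

end QBinomial

/-! ### Refined `q`-trinomial coefficients and their recurrences. -/

/-- The coefficient of `z ^ t` in the expansion of `1 / (z ^ 2; q)_(A + 1)`. -/
noncomputable def evenBinom (q : ℂ) (t A : ℤ) : ℂ :=
  if Even t then qBinom q (A + t / 2) A else 0

theorem evenBinom_of_neg (q : ℂ) {t A : ℤ} (h : t < 0) : evenBinom q t A = 0 := by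
  rw [evenBinom]
  split_ifs
  · exact qBinom_of_lt q (by omega)
  · rfl

theorem evenBinom_of_neg_right (q : ℂ) {t A : ℤ} (h : A < 0) : evenBinom q t A = 0 := by
  rw [evenBinom, qBinom_of_neg q h, ite_self]

/-- Multiplication by 1 - z² q^A removes the last factor of the denominator. At A = t = 0 the true
coefficient is 1, but the convention for A - 1 = -1 gives 0; `evenBinom_zero_sub` covers A = 0. -/
theorem evenBinom_sub {q : ℂ} (hq0 : q ≠ 0) (hq : ‖q‖ < 1) {t A : ℤ} (h : A ≠ 0 ∨ t ≠ 0) :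
    evenBinom q t A - q ^ A * evenBinom q (t - 2) A = evenBinom q t (A - 1) := by
  rw [evenBinom, evenBinom, evenBinom]
  by_cases ht : Even t
  · have ht' : Even (t - 2) := ht.sub (by decide)
    obtain ⟨s, hs⟩ := ht
    rw [if_pos ⟨s, hs⟩, if_pos ht', if_pos ⟨s, hs⟩, qBinom_pascal' hq0 hq (by omega),
      show A + t / 2 - 1 = A + (t - 2) / 2 by omega, show A - 1 + t / 2 = A + (t - 2) / 2 by omega]
    ring
  · have ht' : ¬ Even (t - 2) := by
      intro h'; exact ht (by simpa using h'.add (by decide : Even (2 : ℤ)))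
    simp [ht, ht']

theorem evenBinom_zero_sub {q : ℂ} (hq : ‖q‖ < 1) (t : ℤ) :
    evenBinom q t 0 - evenBinom q (t - 2) 0 = if t = 0 then 1 else 0 := by
  split_ifs with h
  · subst h
    rw [evenBinom_of_neg q (by omega : (0 : ℤ) - 2 < 0), evenBinom, if_pos (by decide)]
    simp [qBinom_zero_right hq]
  · rcases lt_or_gt_of_ne h with h | h
    · rw [evenBinom_of_neg q h, evenBinom_of_neg q (by omega), sub_zero]
    · rw [evenBinom, evenBinom]
      by_cases ht : Even t
      · have ht' : Even (t - 2) := ht.sub (by decide)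
        obtain ⟨s, hs⟩ := ht
        rw [if_pos ⟨s, hs⟩, if_pos ht', qBinom_zero_right hq (by omega),
          qBinom_zero_right hq (by omega), sub_self]
      · have ht' : ¬ Even (t - 2) := by
          intro h'; exact ht (by simpa using h'.add (by decide : Even (2 : ℤ)))
        simp [ht, ht']

theorem sum_range_shift (f : ℤ → ℂ) (N : ℕ) (h0 : f (-1) = 0) (h1 : f ((N : ℤ) - 1) = 0) :
    ∑ n ∈ Finset.range N, f ((n : ℤ) - 1) = ∑ n ∈ Finset.range N, f n := by
  cases N with
  | zero => simp
  | succ N =>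
    rw [Finset.sum_range_succ', Finset.sum_range_succ]
    push_cast at h1 ⊢
    simp only [add_sub_cancel_right] at h1 ⊢
    simp [h0, h1]

/-- A two-sided form of Warnaar's refined `q`-trinomial coefficients in the base `p ^ 2`, with
independent lower parameters. -/
noncomputable def refinedSum (p : ℂ) (K a : ℤ) (M : ℕ) (A C : ℤ) : ℂ :=
  ∑ n ∈ Finset.range (M + 1), p ^ (n ^ 2) * qBinom (p ^ 2) M n *
    evenBinom (p ^ 2) (K - n - a) A * evenBinom (p ^ 2) (K - n + a) C

/-- Warnaar's refined `q`-trinomial coefficient in the base `p ^ 2`. -/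
noncomputable def refinedTrinomial (p : ℂ) (K : ℤ) (M : ℕ) (a b : ℤ) : ℂ :=
  refinedSum p K a M (M + b) (M - b)

section Refined

variable {p : ℂ}

theorem refinedSum_of_lt (p : ℂ) {K a : ℤ} (M : ℕ) (A C : ℤ) (h : K < |a|) :
    refinedSum p K a M A C = 0 := by
  refine Finset.sum_eq_zero fun n _ => ?_
  rcases abs_cases a with ⟨h1, _⟩ | ⟨h1, _⟩
  · rw [evenBinom_of_neg _ (by omega : K - n - a < 0)]; ring
  · rw [evenBinom_of_neg _ (by omega : K - n + a < 0)]; ring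

theorem refinedSum_of_neg_left (p : ℂ) (K a : ℤ) (M : ℕ) {A : ℤ} (C : ℤ) (h : A < 0) :
    refinedSum p K a M A C = 0 :=
  Finset.sum_eq_zero fun n _ => by rw [evenBinom_of_neg_right _ h]; ring

theorem refinedSum_of_neg_right (p : ℂ) (K a : ℤ) (M : ℕ) (A : ℤ) {C : ℤ} (h : C < 0) :
    refinedSum p K a M A C = 0 :=
  Finset.sum_eq_zero fun n _ => by rw [evenBinom_of_neg_right _ h]; ring

theorem refinedSum_neg (p : ℂ) (K a : ℤ) (M : ℕ) (A C : ℤ) :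
    refinedSum p K (-a) M A C = refinedSum p K a M C A := by
  refine Finset.sum_congr rfl fun n _ => ?_
  rw [sub_neg_eq_add, ← sub_eq_add_neg]; ring

theorem refinedTrinomial_neg (p : ℂ) (K : ℤ) (M : ℕ) (a b : ℤ) :
    refinedTrinomial p K M (-a) (-b) = refinedTrinomial p K M a b := by
  rw [refinedTrinomial, refinedSum_neg, refinedTrinomial, sub_neg_eq_add, ← sub_eq_add_neg]

theorem refinedTrinomial_of_lt (p : ℂ) {K : ℤ} (M : ℕ) {a : ℤ} (b : ℤ) (h : K < |a|) :
    refinedTrinomial p K M a b = 0 := refinedSum_of_lt p M _ _ h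

theorem refinedTrinomial_of_lt_abs (p : ℂ) (K : ℤ) {M : ℕ} (a : ℤ) {b : ℤ} (h : M < |b|) :
    refinedTrinomial p K M a b = 0 := by
  rcases abs_cases b with ⟨h1, _⟩ | ⟨h1, _⟩
  · exact refinedSum_of_neg_right p K a M _ (by omega)
  · exact refinedSum_of_neg_left p K a M _ (by omega)

/-- Cancels the factor 1 - u² p^(2A) in the generating function; u² corresponds to the shift (K, a)
↦ (K-1, a+1). -/
theorem refinedSum_sub_left (hp0 : p ≠ 0) (hp : ‖p‖ < 1) (K a : ℤ) (M : ℕ) {A : ℤ} (C : ℤ)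
    (hA : A ≠ 0) :
    refinedSum p K a M A C - (p ^ 2) ^ A * refinedSum p (K - 1) (a + 1) M A C =
      refinedSum p K a M (A - 1) C := by
  rw [refinedSum, refinedSum, refinedSum, Finset.mul_sum, ← Finset.sum_sub_distrib]
  refine Finset.sum_congr rfl fun n _ => ?_
  rw [← evenBinom_sub (pow_ne_zero 2 hp0) (norm_sq_lt_one hp) (t := K - n - a) (Or.inl hA),
    show K - 1 - n - (a + 1) = K - n - a - 2 by ring, show K - 1 - n + (a + 1) = K - n + a by ring]
  ring

theorem refinedSum_sub_right (hp0 : p ≠ 0) (hp : ‖p‖ < 1) (K a : ℤ) (M : ℕ) (A : ℤ) {C : ℤ}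
    (h : C ≠ 0 ∨ 0 < a) :
    refinedSum p K a M A C - (p ^ 2) ^ C * refinedSum p (K - 1) (a - 1) M A C =
      refinedSum p K a M A (C - 1) := by
  rw [refinedSum, refinedSum, refinedSum, Finset.mul_sum, ← Finset.sum_sub_distrib]
  refine Finset.sum_congr rfl fun n _ => ?_
  rw [show K - 1 - n - (a - 1) = K - n - a by ring,
    show K - 1 - n + (a - 1) = K - n + a - 2 by ring]
  by_cases h' : C ≠ 0 ∨ K - n + a ≠ 0
  · rw [← evenBinom_sub (pow_ne_zero 2 hp0) (norm_sq_lt_one hp) h']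
    ring
  · rw [evenBinom_of_neg _ (by omega : K - n - a < 0)]
    ring

/-- The new numerator factor is 1 + u v p^(2M+1), and u v corresponds to K ↦ K-1. -/
theorem refinedSum_succ (hp0 : p ≠ 0) (hp : ‖p‖ < 1) (K a : ℤ) (M : ℕ) (A C : ℤ) :
    refinedSum p K a (M + 1) A C =
      refinedSum p K a M A C + p ^ (2 * M + 1) * refinedSum p (K - 1) a M A C := by
  have h := sum_qBinom_succ hp0 hp M
    fun n => evenBinom (p ^ 2) (K - n - a) A * evenBinom (p ^ 2) (K - n + a) C
  simp only [refinedSum, mul_assoc] at h ⊢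
  rw [h]
  congr 2
  refine Finset.sum_congr rfl fun n _ => ?_
  push_cast
  rw [show K - 1 - n - a = K - (n + 1) - a by ring, show K - 1 - n + a = K - (n + 1) + a by ring]

/-- Cancelling the last factor in both u² and v² lowers both lower parameters to M; the numerator
then still has one factor too many, which gives the two terms on the right. -/
theorem refinedTrinomial_zero_succ (hp0 : p ≠ 0) (hp : ‖p‖ < 1) (K : ℤ) (M : ℕ) (a : ℤ) :
    refinedTrinomial p K (M + 1) a 0 - (p ^ 2) ^ (M + 1) *
        (refinedTrinomial p (K - 1) (M + 1) (a + 1) 0 +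
          refinedTrinomial p (K - 1) (M + 1) (a - 1) 0) +
        (p ^ 2) ^ (2 * (M + 1)) * refinedTrinomial p (K - 2) (M + 1) a 0 =
      refinedTrinomial p K M a 0 + p ^ (2 * M + 1) * refinedTrinomial p (K - 1) M a 0 := by
  simp only [refinedTrinomial, add_zero, sub_zero]
  rw [← refinedSum_succ hp0 hp]
  have hM : ((M + 1 : ℕ) : ℤ) ≠ 0 := by omega
  have h1 := fun K a => refinedSum_sub_left hp0 hp K a (M + 1) ((M + 1 : ℕ) : ℤ) hM
  have h2 := refinedSum_sub_right hp0 hp K a (M + 1) (((M + 1 : ℕ) : ℤ) - 1) (Or.inl hM)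
  rw [← h1 K a, ← h1 (K - 1) (a - 1), sub_add_cancel, show K - 1 - 1 = K - 2 by ring,
    zpow_natCast] at h2
  rw [show (M : ℤ) = ((M + 1 : ℕ) : ℤ) - 1 by push_cast; ring, ← h2]
  ring

theorem refinedTrinomial_zero_zero (hp : ‖p‖ < 1) (K a : ℤ) :
    refinedTrinomial p K 0 a 0 - (refinedTrinomial p (K - 1) 0 (a + 1) 0 +
        refinedTrinomial p (K - 1) 0 (a - 1) 0) + refinedTrinomial p (K - 2) 0 a 0 =
      if K = 0 ∧ a = 0 then 1 else 0 := by
  have hq := norm_sq_lt_one hp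
  have h (K a : ℤ) : refinedTrinomial p K 0 a 0 =
      evenBinom (p ^ 2) (K - a) 0 * evenBinom (p ^ 2) (K + a) 0 := by
    simp [refinedTrinomial, refinedSum, qBinom_zero_right hq]
  rw [h, h, h, h, show K - 1 - (a + 1) = K - a - 2 by ring, show K - 1 - (a - 1) = K - a by ring,
    show K - 1 + (a + 1) = K + a by ring, show K - 1 + (a - 1) = K + a - 2 by ring,
    show K - 2 - a = K - a - 2 by ring, show K - 2 + a = K + a - 2 by ring]
  have h1 := evenBinom_zero_sub hq (K - a)
  have h2 := evenBinom_zero_sub hq (K + a)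
  have h3 : (if K = 0 ∧ a = 0 then (1 : ℂ) else 0) =
      (if K - a = 0 then 1 else 0) * (if K + a = 0 then 1 else 0) := by
    rw [ite_zero_mul_ite_zero, one_mul]
    exact if_congr (by omega) rfl rfl
  rw [h3, ← h1, ← h2]
  ring

end Refined

/-! ### Stability of the refined `q`-trinomials under the transform. -/

/-- The transformation of sequences under which the refined `q`-trinomial coefficients are
stable. -/
noncomputable def refinedTransform (p : ℂ) (F : ℤ → ℕ → ℂ) (L : ℤ) (M : ℕ) : ℂ :=
  ∑ i ∈ Finset.range (M + 1), p ^ (i ^ 2) * qBinom (p ^ 2) (L + M - i) L * F (L - i) i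

section Transform

variable {p : ℂ}

theorem refinedTransform_eq_sum_succ (p : ℂ) (F : ℤ → ℕ → ℂ) (L : ℤ) (M : ℕ) :
    refinedTransform p F L M =
      ∑ i ∈ Finset.range (M + 2), p ^ (i ^ 2) * qBinom (p ^ 2) (L + M - i) L * F (L - i) i := by
  rw [Finset.sum_range_succ, ← refinedTransform, qBinom_of_lt _ (by push_cast; omega)]
  ring

/-- This is the recurrence of `refinedTrinomial_zero_succ`, now for the transformed sequence. -/
theorem refinedTransform_zero_succ (hp0 : p ≠ 0) (hp : ‖p‖ < 1) (L : ℤ) (M : ℕ) (a : ℤ) :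
    refinedTransform p (fun K i => refinedTrinomial p K i a 0) L (M + 1) - (p ^ 2) ^ (M + 1) *
        (refinedTransform p (fun K i => refinedTrinomial p K i (a + 1) 0) (L - 1) (M + 1) +
          refinedTransform p (fun K i => refinedTrinomial p K i (a - 1) 0) (L - 1) (M + 1)) +
        (p ^ 2) ^ (2 * (M + 1)) *
          refinedTransform p (fun K i => refinedTrinomial p K i a 0) (L - 2) (M + 1) =
      refinedTransform p (fun K i => refinedTrinomial p K i a 0) L M +
        p ^ (2 * M + 1) *
          refinedTransform p (fun K i => refinedTrinomial p K i a 0) (L - 1) M := by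
  have hq0 := pow_ne_zero 2 hp0
  have hq := norm_sq_lt_one hp
  set D : ℤ → ℕ → ℂ := fun K i => refinedTrinomial p K i a 0 - (p ^ 2) ^ i *
    (refinedTrinomial p (K - 1) i (a + 1) 0 + refinedTrinomial p (K - 1) i (a - 1) 0) +
    (p ^ 2) ^ (2 * i) * refinedTrinomial p (K - 2) i a 0 with hD
  have hDs (K : ℤ) (i : ℕ) : D K (i + 1) =
      refinedTrinomial p K i a 0 + p ^ (2 * i + 1) * refinedTrinomial p (K - 1) i a 0 :=
    refinedTrinomial_zero_succ hp0 hp K i a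
  -- Telescoping certificate: by Pascal's rule on the kernel and `hDs`, the difference of the two
  -- sides has i-th term `X i - X (i + 1)`.
  set X : ℕ → ℂ := fun i => p ^ (i ^ 2) * (p ^ 2) ^ ((M : ℤ) + 1 - i) *
    qBinom (p ^ 2) (L + M - i) (L - 1) * D (L - i) i with hX
  have h0 : X 0 = 0 := by
    have : D L 0 = if L = 0 ∧ a = 0 then 1 else 0 := by
      rw [← refinedTrinomial_zero_zero hp, hD]; ring
    simp only [hX, Nat.cast_zero, sub_zero, this]
    split_ifs with h
    · rw [qBinom_of_neg _ (by omega)]; ring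
    · ring
  have h1 : X (M + 2) = 0 := by
    simp only [hX]
    rw [qBinom_of_lt _ (by push_cast; omega)]; ring
  have key : ∑ i ∈ Finset.range (M + 2), (X i - X (i + 1)) = 0 := by
    rw [Finset.sum_range_sub', h0, h1, sub_zero]
  rw [refinedTransform, refinedTransform, refinedTransform, refinedTransform,
    refinedTransform_eq_sum_succ, refinedTransform_eq_sum_succ, ← sub_eq_zero, ← key]
  simp only [Finset.mul_sum, ← Finset.sum_add_distrib, ← Finset.sum_sub_distrib]
  refine Finset.sum_congr rfl fun i hi => ?_
  simp only [hX, hDs]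
  have e1 : p ^ (2 * i + 1) * (p ^ 2) ^ ((M : ℤ) + 1 - ((i + 1 : ℕ) : ℤ)) = p ^ (2 * M + 1) := by
    rw [pow_succ, pow_mul, mul_right_comm, ← zpow_natCast (p ^ 2) i, ← zpow_add₀ hq0,
      show (i : ℤ) + (M + 1 - ((i + 1 : ℕ) : ℤ)) = M by push_cast; ring, zpow_natCast]
    ring
  have e2 : (p ^ 2) ^ ((M : ℤ) + 1 - i) = p ^ 2 * (p ^ 2) ^ ((M : ℤ) + 1 - ((i + 1 : ℕ) : ℤ)) := by
    rw [← zpow_one_add₀ hq0]; congr 1; push_cast; ring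
  have hT (k : ℤ) (hk : k < 0) : refinedTrinomial p k i a 0 = 0 :=
    refinedTrinomial_of_lt p i 0 (hk.trans_le (abs_nonneg a))
  -- At the exceptional point of Pascal's rule the refined trinomial has negative first argument and
  -- vanishes; likewise in `e4`.
  have e3 : (qBinom (p ^ 2) (L + M + 1 - i) L - qBinom (p ^ 2) (L + M - i) L -
      (p ^ 2) ^ ((M : ℤ) + 1 - i) * qBinom (p ^ 2) (L + M - i) (L - 1)) *
      refinedTrinomial p (L - i) i a 0 = 0 := by
    by_cases h : L + M + 1 - i ≠ 0 ∨ L ≠ 0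
    · rw [qBinom_pascal hq0 hq h, show L + M + 1 - i - 1 = L + M - i by ring,
        show L + M + 1 - i - L = (M : ℤ) + 1 - i by ring]
      ring
    · rw [hT _ (by omega)]; ring
  have e4 : (qBinom (p ^ 2) (L + M - i) (L - 1) - qBinom (p ^ 2) (L + M - 1 - i) (L - 1) -
      (p ^ 2) ^ ((M : ℤ) + 1 - i) * qBinom (p ^ 2) (L + M - 1 - i) (L - 2)) *
      refinedTrinomial p (L - 2 - i) i a 0 = 0 := by
    by_cases h : L + M - i ≠ 0 ∨ L - 1 ≠ 0
    · rw [qBinom_pascal hq0 hq h, show L + M - i - 1 = L + M - 1 - i by ring,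
        show L + M - i - (L - 1) = (M : ℤ) + 1 - i by ring, show L - 1 - 1 = L - 2 by ring]
      ring
    · rw [hT _ (by omega)]; ring
  rw [e2] at e3 e4
  simp only [hD]
  rw [e2]
  push_cast at e1 e3 e4 ⊢
  rw [show L + (M + 1) - i = L + M + 1 - i by ring, show L - 1 + (M + 1 : ℤ) - i = L + M - i by ring,
    show L - 2 + (M + 1 : ℤ) - i = L + M - 1 - i by ring,
    show L - 1 + (M : ℤ) - i = L + M - 1 - i by ring,
    show L + (M : ℤ) - (i + 1) = L + M - 1 - i by ring, show L - (i : ℤ) - 1 = L - 1 - i by ring,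
    show L - (i : ℤ) - 2 = L - 2 - i by ring, show L - (i + 1 : ℤ) = L - 1 - i by ring,
    show L - 1 - (i : ℤ) - 1 = L - 2 - i by ring]
  rw [show (p ^ 2) ^ (2 * (M + 1)) = p ^ 2 * (p ^ (2 * M + 1)) ^ 2 by ring,
    show (p ^ 2) ^ (M + 1) = p * p ^ (2 * M + 1) by ring, ← e1]
  linear_combination p ^ i ^ 2 * e3 -
    p ^ i ^ 2 * p ^ 2 * (p ^ 2) ^ ((M : ℤ) + 1 - (i + 1)) * (p ^ 2) ^ (2 * i) * e4

theorem refinedTrinomial_transform_zero (hp0 : p ≠ 0) (hp : ‖p‖ < 1) (M : ℕ) (L a : ℤ) :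
    refinedTransform p (fun K i => refinedTrinomial p K i a 0) L M =
      refinedTrinomial p L M a 0 := by
  have hq := norm_sq_lt_one hp
  have hneg (M : ℕ) {L : ℤ} (hL : L < 0) (a : ℤ) :
      refinedTransform p (fun K i => refinedTrinomial p K i a 0) L M =
        refinedTrinomial p L M a 0 := by
    rw [refinedTrinomial_of_lt p M 0 (hL.trans_le (abs_nonneg a))]
    exact Finset.sum_eq_zero fun i _ => by rw [qBinom_of_neg _ hL]; ring
  induction M generalizing L a with
  | zero =>
    rcases lt_or_ge L 0 with hL | hL
    · exact hneg 0 hL a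
    · simp [refinedTransform, qBinom_self hq hL]
  | succ M ih =>
    rcases lt_or_ge L 0 with hL | hL
    · exact hneg _ hL a
    lift L to ℕ using hL
    induction L using Nat.strong_induction_on generalizing a with
    | _ L ihL =>
      have ih' (L' : ℤ) (h : L' < L) (a : ℤ) :
          refinedTransform p (fun K i => refinedTrinomial p K i a 0) L' (M + 1) =
            refinedTrinomial p L' (M + 1) a 0 := by
        rcases lt_or_ge L' 0 with hL | hL
        · exact hneg _ hL a
        · lift L' to ℕ using hL
          exact ihL L' (by omega) a
      have h1 := refinedTransform_zero_succ hp0 hp L M a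
      have h2 := refinedTrinomial_zero_succ hp0 hp L M a
      rw [ih, ih, ih' (L - 1) (by omega), ih' (L - 1) (by omega), ih' (L - 2) (by omega)] at h1
      linear_combination h1 - h2

theorem refinedTrinomial_sub_left (hp0 : p ≠ 0) (hp : ‖p‖ < 1) (K a : ℤ) (M b : ℕ) :
    refinedTrinomial p K M a (b + 1) -
        (p ^ 2) ^ (M + b + 1) * refinedTrinomial p (K - 1) M (a + 1) (b + 1) =
      refinedSum p K a M (M + b) (M - b - 1) := by
  have := refinedSum_sub_left hp0 hp K a M (A := M + (b + 1)) (M - (b + 1)) (by omega)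
  rw [show (M : ℤ) + (b + 1) - 1 = M + b by ring,
    show (M : ℤ) - (b + 1) = M - b - 1 by ring] at this
  rw [← this, refinedTrinomial, refinedTrinomial, show (M : ℤ) - (b + 1) = M - b - 1 by ring,
    ← zpow_natCast (p ^ 2) (M + b + 1)]
  push_cast
  rw [add_assoc (M : ℤ) b 1]

theorem refinedTrinomial_sub_right (hp0 : p ≠ 0) (hp : ‖p‖ < 1) (K : ℤ) {a : ℤ} (ha : 0 ≤ a)
    (M b : ℕ) :
    refinedTrinomial p K M (a + 1) b -
        (p ^ 2) ^ ((M : ℤ) - b) * refinedTrinomial p (K - 1) M a b =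
      refinedSum p K (a + 1) M (M + b) (M - b - 1) := by
  have := refinedSum_sub_right hp0 hp K (a + 1) M (M + b) (C := M - b) (by omega)
  rwa [add_sub_cancel_right] at this

/-- With y = u/v for the shift a ↦ a+1 and q = p², this is the identity (1 + u v p^(2i+1)) (p -
q^(b+1) y) = p (1 - u² q^(i+b+1)) - q^(b+1) y (1 - v² q^(i-b)). -/
theorem refinedSum_succ_relation (hp0 : p ≠ 0) (hp : ‖p‖ < 1) (K : ℤ) {a : ℤ} (ha : 0 ≤ a)
    (i b : ℕ) :
    p * refinedSum p K a (i + 1) ((i + 1 : ℕ) + b) ((i + 1 : ℕ) - b - 1) -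
        (p ^ 2) ^ (b + 1) *
          refinedSum p K (a + 1) (i + 1) ((i + 1 : ℕ) + b) ((i + 1 : ℕ) - b - 1) =
      p * refinedTrinomial p K i a b -
        (p ^ 2) ^ (b + 1) * refinedTrinomial p K i (a + 1) (b + 1) := by
  have hq0 := pow_ne_zero 2 hp0
  have h1 := refinedSum_sub_left hp0 hp K a i (A := (i : ℤ) + b + 1) (i - b) (by omega)
  have h2 := refinedSum_sub_right hp0 hp K (a + 1) i ((i : ℤ) + b + 1) (C := i - b) (by omega)
  rw [add_sub_cancel_right] at h1 h2
  push_cast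
  rw [show (i : ℤ) + 1 + b = i + b + 1 by ring, show (i : ℤ) + 1 - b - 1 = i - b by ring,
    refinedSum_succ hp0 hp, refinedSum_succ hp0 hp, refinedTrinomial, refinedTrinomial, ← h1,
    ← add_assoc, ← sub_sub, ← h2]
  have e1 : (p ^ 2) ^ ((i : ℤ) + b + 1) = (p ^ 2) ^ i * (p ^ 2) ^ (b + 1) := by
    rw [← pow_add, ← zpow_natCast (p ^ 2) (i + (b + 1))]; congr 1
  have e2 : (p ^ 2) ^ ((i : ℤ) - b) * (p ^ 2) ^ (b + 1) = (p ^ 2) ^ (i + 1) := by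
    rw [← zpow_natCast (p ^ 2) (b + 1), ← zpow_natCast (p ^ 2) (i + 1), ← zpow_add₀ hq0]
    congr 1; push_cast; ring
  rw [e1]
  linear_combination refinedSum p (K - 1) a i (i + b + 1) (i - b) * -e2

theorem refinedTransform_succ (hp0 : p ≠ 0) (hp : ‖p‖ < 1) (L : ℤ) {a : ℤ} (ha : 0 ≤ a)
    (M b : ℕ) :
    refinedTransform p (fun K i => refinedTrinomial p K i a (b + 1)) L M -
        (p ^ 2) ^ (M + b + 1) *
          refinedTransform p (fun K i => refinedTrinomial p K i (a + 1) (b + 1)) (L - 1) M =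
      p ^ (2 * b + 1) * (refinedTransform p (fun K i => refinedTrinomial p K i (a + 1) b) L M -
        (p ^ 2) ^ ((M : ℤ) - b) *
          refinedTransform p (fun K i => refinedTrinomial p K i a b) (L - 1) M) := by
  have hq0 := pow_ne_zero 2 hp0
  have hq := norm_sq_lt_one hp
  set w : ℤ → ℕ → ℤ → ℂ := fun K i a => refinedSum p K a i (i + b) (i - b - 1) with hw
  -- `refinedSum_succ_relation` lowers the level of `W (i + 1)` to i, so that `W (i + 1) - W i` is
  -- the combination in `hWs`. Summation by parts against the kernel then telescopes.
  set W : ℕ → ℂ := fun i =>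
    p ^ (i ^ 2) * (w (L - i) i a - p ^ (2 * b + 1) * w (L - i) i (a + 1)) with hW
  set X : ℕ → ℂ := fun i => qBinom (p ^ 2) (L + M - i) L * W i with hX
  have h0 : X 0 = 0 := by
    simp only [hX, hW, hw]
    rw [refinedSum_of_neg_right _ _ _ _ _ (by simp; omega),
      refinedSum_of_neg_right _ _ _ _ _ (by simp; omega)]
    ring
  have h1 : X (M + 1) = 0 := by
    simp only [hX]
    rw [qBinom_of_lt _ (by push_cast; omega)]; ring
  have key : ∑ i ∈ Finset.range (M + 1), (X i - X (i + 1)) = 0 := by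
    rw [Finset.sum_range_sub', h0, h1, sub_zero]
  rw [refinedTransform, refinedTransform, refinedTransform, refinedTransform, ← sub_eq_zero, ← key]
  simp only [Finset.mul_sum, mul_sub, ← Finset.sum_sub_distrib]
  refine Finset.sum_congr rfl fun i hi => ?_
  have hi' := Finset.mem_range.mp hi
  have r1 := refinedTrinomial_sub_left hp0 hp (L - i) a i b
  have r2 := refinedTrinomial_sub_right hp0 hp (L - i) ha i b
  have r3 := refinedSum_succ_relation hp0 hp (L - ((i + 1 : ℕ) : ℤ)) ha i b
  have e2 : p ^ (2 * b + 1) * (p ^ 2) ^ ((i : ℤ) - b) = p ^ (2 * i + 1) := by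
    rw [pow_succ, pow_mul, mul_right_comm, ← zpow_natCast (p ^ 2) b, ← zpow_add₀ hq0,
      add_sub_cancel, zpow_natCast]
    ring
  have hK : L - ((i + 1 : ℕ) : ℤ) = L - i - 1 := by push_cast; ring
  have hWs : W (i + 1) = W i - p ^ (i ^ 2) * (refinedTrinomial p (L - i) i a (b + 1) -
      p ^ (2 * b + 1) * refinedTrinomial p (L - i) i (a + 1) b) := by
    simp only [hW, hw]
    rw [hK] at r3 ⊢
    linear_combination p ^ (i ^ 2 + 2 * i) * r3 + p ^ (i ^ 2) * r1 -
      p ^ (i ^ 2) * p ^ (2 * b + 1) * r2 -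
      p ^ (i ^ 2) * refinedTrinomial p (L - i - 1) i a b * e2
  have e3 (x : ℂ) (hx : L - i - 1 < 0 → x = 0) :
      (qBinom (p ^ 2) (L + M - i) L - qBinom (p ^ 2) (L + M - i - 1) L -
      (p ^ 2) ^ ((M : ℤ) - i) * qBinom (p ^ 2) (L + M - i - 1) (L - 1)) * x = 0 := by
    by_cases h : L + M - i ≠ 0 ∨ L ≠ 0
    · rw [qBinom_pascal hq0 hq h, show L + M - i - L = (M : ℤ) - i by ring]
      ring
    · rw [hx (by omega), mul_zero]
  have e4 : (p ^ 2) ^ (M + b + 1) = (p ^ 2) ^ ((M : ℤ) - i) * (p ^ 2) ^ (i + b + 1) := by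
    rw [← zpow_natCast (p ^ 2) (M + b + 1), ← zpow_natCast (p ^ 2) (i + b + 1), ← zpow_add₀ hq0]
    congr 1; push_cast; ring
  have e5 : (p ^ 2) ^ ((M : ℤ) - b) = (p ^ 2) ^ ((M : ℤ) - i) * (p ^ 2) ^ ((i : ℤ) - b) := by
    rw [← zpow_add₀ hq0]
    congr 1; ring
  have e6 := e3 (refinedTrinomial p (L - i - 1) i (a + 1) (b + 1))
    fun h => refinedTrinomial_of_lt p i _ (h.trans_le (abs_nonneg _))
  have e7 := e3 (refinedTrinomial p (L - i - 1) i a b)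
    fun h => refinedTrinomial_of_lt p i _ (h.trans_le (abs_nonneg _))
  have hW0 : W i = p ^ (i ^ 2) * (refinedSum p (L - i) a i (i + b) (i - b - 1) -
      p ^ (2 * b + 1) * refinedSum p (L - i) (a + 1) i (i + b) (i - b - 1)) := rfl
  simp only [hX, hWs]
  rw [hW0, ← r1, ← r2, e4, e5, show L + (M : ℤ) - ((i + 1 : ℕ) : ℤ) = L + M - i - 1 by
    push_cast; ring, show L - 1 + (M : ℤ) - i = L + M - i - 1 by ring,
    show L - 1 - (i : ℤ) = L - i - 1 by ring]
  linear_combination p ^ (i ^ 2) * (p ^ 2) ^ (i + b + 1) * e6 -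
    p ^ (i ^ 2) * p ^ (2 * b + 1) * (p ^ 2) ^ ((i : ℤ) - b) * e7

/-- Induction on b, then on L: `refinedTransform_succ` expresses the transform at b+1 through b and
a smaller L, and the right-hand side obeys a matching relation. -/
theorem refinedTrinomial_transform (hp0 : p ≠ 0) (hp : ‖p‖ < 1) (L M : ℕ) {a : ℤ} (ha : 0 ≤ a)
    (b : ℕ) :
    refinedTransform p (fun K i => refinedTrinomial p K i a b) L M =
      p ^ (b ^ 2) * refinedTrinomial p L M (a + b) b := by
  induction b generalizing a L with
  | zero => simpa using refinedTrinomial_transform_zero hp0 hp M L a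
  | succ b ihb =>
    induction L generalizing a with
    | zero =>
      rw [refinedTrinomial_of_lt _ _ _ (lt_of_lt_of_le (by push_cast; omega) (le_abs_self _)),
        mul_zero]
      refine Finset.sum_eq_zero fun i _ => ?_
      cases i with
      | zero =>
        exact mul_eq_zero_of_right _ (refinedTrinomial_of_lt_abs _ _ _
          (lt_of_lt_of_le (by push_cast; omega) (le_abs_self _)))
      | succ i =>
        exact mul_eq_zero_of_right _ (refinedTrinomial_of_lt _ _ _
          (lt_of_lt_of_le (by push_cast; omega) (le_abs_self _)))
    | succ L ih =>
      have h1 := refinedTransform_succ hp0 hp ((L + 1 : ℕ) : ℤ) ha M b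
      -- Cancelling a u-factor at b+1 or a v-factor at b leaves the same `refinedSum`, with lower
      -- parameters M+b and M-b-1.
      have h2 := refinedTrinomial_sub_left hp0 hp ((L + 1 : ℕ) : ℤ) (a + b + 1) M b
      rw [← refinedTrinomial_sub_right hp0 hp _ (by omega) M b] at h2
      have ih' := ih (a := a + 1) (by omega)
      have hL : ((L + 1 : ℕ) : ℤ) - 1 = L := by push_cast; ring
      rw [hL] at h1 h2
      rw [ihb (L + 1) (by omega), ihb L ha] at h1
      push_cast at *
      rw [ih', show a + 1 + (b : ℤ) = a + b + 1 by ring,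
        show a + 1 + ((b : ℤ) + 1) = a + b + 1 + 1 by ring] at h1
      rw [← add_assoc a (b : ℤ) 1]
      linear_combination h1 - p ^ (b + 1) ^ 2 * h2

end Transform

/-! ### Recurrences for the Andrews–Baxter trinomial sum. -/

/-- The `q`-trinomial sum `Σ_n q^(n (n + c)) / ((q)_n (q)_(n + c) (q)_(L - 2 n - c))`, truncated
at `n < N`. -/
noncomputable def trinomialSum (q : ℂ) (N : ℕ) (L c : ℤ) : ℂ :=
  ∑ n ∈ Finset.range N, q ^ ((n : ℤ) * (n + c)) *
    (qPochRecip q n * qPochRecip q (n + c) * qPochRecip q (L - 2 * n - c))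

section TrinomialSum

variable {q : ℂ}

theorem trinomialSum_of_lt (q : ℂ) (N : ℕ) {L c : ℤ} (h : L < |c|) : trinomialSum q N L c = 0 := by
  refine Finset.sum_eq_zero fun n _ => ?_
  rcases lt_or_ge ((n : ℤ) + c) 0 with h1 | h1
  · rw [qPochRecip_of_neg q h1]; ring
  · rcases abs_cases c with ⟨h2, _⟩ | ⟨h2, _⟩
    · rw [qPochRecip_of_neg q (by omega : L - 2 * n - c < 0)]; ring
    · rw [qPochRecip_of_neg q (by omega : L - 2 * n - c < 0)]; ring

theorem trinomialSum_shift (q : ℂ) {N : ℕ} {L : ℤ} (c : ℤ) (h : L < N - 1) :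
    trinomialSum q N L c = ∑ n ∈ Finset.range N, q ^ (((n : ℤ) - 1) * (n - 1 + c)) *
      (qPochRecip q (n - 1) * qPochRecip q (n - 1 + c) * qPochRecip q (L - 2 * (n - 1) - c)) := by
  refine (sum_range_shift (fun n => q ^ (n * (n + c)) * (qPochRecip q n * qPochRecip q (n + c) *
    qPochRecip q (L - 2 * n - c))) N ?_ ?_).symm
  · rw [qPochRecip_of_neg q (by omega : (-1 : ℤ) < 0)]; ring
  · rcases lt_or_ge ((N : ℤ) - 1 + c) 0 with h1 | h1
    · rw [qPochRecip_of_neg q h1]; ring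
    · rw [qPochRecip_of_neg q (by omega : L - 2 * ((N : ℤ) - 1) - c < 0)]; ring

/-- After shifting n in two of the sums it holds termwise. With x = q^n, y = q^(n+a), z = q^(L-2n-a)
it reads 1 - xyz = (1-z) + z((1-x)y + (1-y)x + (1-x)(1-y)). -/
theorem trinomialSum_recurrence (hq0 : q ≠ 0) (hq : ‖q‖ < 1) {N : ℕ} {L : ℤ} (a : ℤ) (h : L < N) :
    (1 - q ^ L) * trinomialSum q N L a = trinomialSum q N (L - 1) a +
      q ^ (L + a) * trinomialSum q N (L - 1) (a + 1) +
      q ^ (L - a) * trinomialSum q N (L - 1) (a - 1) +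
      q ^ (L - 1) * trinomialSum q N (L - 2) a := by
  rw [trinomialSum_shift q (a + 1) (by omega : L - 1 < N - 1),
    trinomialSum_shift q a (by omega : L - 2 < N - 1), trinomialSum, trinomialSum, trinomialSum]
  simp only [Finset.mul_sum, ← Finset.sum_add_distrib]
  refine Finset.sum_congr rfl fun n _ => ?_
  rw [show L - 1 - 2 * (n : ℤ) - a = L - 2 * n - a - 1 by ring,
    show (n : ℤ) - 1 + (a + 1) = n + a by ring,
    show L - 1 - 2 * ((n : ℤ) - 1) - (a + 1) = L - 2 * n - a by ring,
    show (n : ℤ) + (a - 1) = n + a - 1 by ring,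
    show L - 1 - 2 * (n : ℤ) - (a - 1) = L - 2 * n - a by ring,
    show (n : ℤ) - 1 + a = n + a - 1 by ring,
    show L - 2 - 2 * ((n : ℤ) - 1) - a = L - 2 * n - a by ring,
    ← qPochRecip_mul hq n, ← qPochRecip_mul hq (n + a), ← qPochRecip_mul hq (L - 2 * n - a)]
  have e0 : q ^ L = q ^ (n : ℤ) * q ^ ((n : ℤ) + a) * q ^ (L - 2 * n - a) := by
    rw [← zpow_add₀ hq0, ← zpow_add₀ hq0]; congr 1; ring
  have e1 : q ^ (L + a) * q ^ (((n : ℤ) - 1) * (n + a)) =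
      q ^ ((n : ℤ) * (n + a)) * (q ^ ((n : ℤ) + a) * q ^ (L - 2 * n - a)) := by
    simp only [← zpow_add₀ hq0]; congr 1; ring
  have e2 : q ^ (L - a) * q ^ ((n : ℤ) * (n + a - 1)) =
      q ^ ((n : ℤ) * (n + a)) * (q ^ (n : ℤ) * q ^ (L - 2 * n - a)) := by
    simp only [← zpow_add₀ hq0]; congr 1; ring
  have e3 : q ^ (L - 1) * q ^ (((n : ℤ) - 1) * (n + a - 1)) =
      q ^ ((n : ℤ) * (n + a)) * q ^ (L - 2 * n - a) := by
    simp only [← zpow_add₀ hq0]; congr 1; ring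
  rw [e0]
  simp only [← mul_assoc] at e1 e2 e3 ⊢
  rw [e1, e2, e3]
  ring

theorem trinomialSum_relation (hq0 : q ≠ 0) (hq : ‖q‖ < 1) {N : ℕ} {L : ℤ} (c : ℤ) (h : L < N) :
    (1 - q ^ c) * trinomialSum q N L c =
      trinomialSum q N (L - 1) (c - 1) - q ^ c * trinomialSum q N (L - 1) (c + 1) := by
  rw [trinomialSum_shift q (c + 1) (by omega : L - 1 < N - 1), trinomialSum, trinomialSum]
  simp only [Finset.mul_sum, ← Finset.sum_sub_distrib]
  refine Finset.sum_congr rfl fun n _ => ?_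
  rw [show (n : ℤ) - 1 + (c + 1) = n + c by ring,
    show L - 1 - 2 * ((n : ℤ) - 1) - (c + 1) = L - 2 * n - c by ring,
    show (n : ℤ) + (c - 1) = n + c - 1 by ring,
    show L - 1 - 2 * (n : ℤ) - (c - 1) = L - 2 * n - c by ring,
    ← qPochRecip_mul hq n, ← qPochRecip_mul hq (n + c)]
  have e0 : q ^ ((n : ℤ) * (n + c)) = q ^ ((n : ℤ) * (n + c - 1)) * q ^ (n : ℤ) := by
    rw [← zpow_add₀ hq0]; congr 1; ring
  have e1 : q ^ c * q ^ (((n : ℤ) - 1) * (n + c)) = q ^ ((n : ℤ) * (n + c - 1)) := by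
    simp only [← zpow_add₀ hq0]; congr 1; ring
  have e2 : q ^ ((n : ℤ) + c) = q ^ c * q ^ (n : ℤ) := by
    rw [← zpow_add₀ hq0]; congr 1; ring
  simp only [← mul_assoc] at e1 ⊢
  rw [e1, e0, e2]
  ring

end TrinomialSum

/-! ### Diagonal sums of refined trinomials. -/

/-- The sum of `p^(K²)` times the refined `q`-trinomial coefficients over `K + M = L`, with
`M < N`. -/
noncomputable def diagonalSum (p : ℂ) (N : ℕ) (L a b : ℤ) : ℂ :=
  ∑ M ∈ Finset.range N, p ^ ((L - M) ^ 2) * refinedTrinomial p (L - M) M a b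

section DiagonalSum

variable {p : ℂ}

theorem diagonalSum_of_lt (p : ℂ) (N : ℕ) {L a : ℤ} (b : ℤ) (h : L < |a|) :
    diagonalSum p N L a b = 0 :=
  Finset.sum_eq_zero fun M _ => by rw [refinedTrinomial_of_lt _ _ _ (by omega), mul_zero]

theorem sum_range_eq_of_succ {g h : ℕ → ℂ} {N : ℕ} (hN : 0 < N) (h0 : g 0 = 0)
    (h1 : ∀ M, g (M + 1) = h M) (h2 : h (N - 1) = 0) :
    ∑ M ∈ Finset.range N, g M = ∑ M ∈ Finset.range N, h M := by
  obtain ⟨N, rfl⟩ : ∃ N', N = N' + 1 := ⟨N - 1, by omega⟩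
  rw [Finset.sum_range_succ', Finset.sum_range_succ, h0]
  simp only [h1, add_tsub_cancel_right] at h2 ⊢
  rw [h2]

/-- The weight p^(K²) turns the coefficients of `refinedTrinomial_zero_succ`, which depend on M,
into coefficients depending only on the diagonal. Term M+1 on the left matches term M on the right.
-/
theorem diagonalSum_zero_recurrence (hp0 : p ≠ 0) (hp : ‖p‖ < 1) {N : ℕ} {L : ℤ} (a : ℤ)
    (hL : 0 < L) (h : L < N) :
    diagonalSum p N L a 0 - p ^ (2 * L - 1) *
        (diagonalSum p N (L - 1) (a + 1) 0 + diagonalSum p N (L - 1) (a - 1) 0) +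
        p ^ (4 * L - 4) * diagonalSum p N (L - 2) a 0 =
      diagonalSum p N (L - 1) a 0 + p ^ (2 * L - 2) * diagonalSum p N (L - 2) a 0 := by
  simp only [diagonalSum, Finset.mul_sum, ← Finset.sum_add_distrib, ← Finset.sum_sub_distrib]
  refine sum_range_eq_of_succ (by omega) ?_ (fun M => ?_) ?_
  · have := refinedTrinomial_zero_zero hp L a
    rw [if_neg (by omega)] at this
    simp only [Nat.cast_zero, sub_zero]
    have e1 : p ^ (2 * L - 1) * p ^ ((L - 1) ^ 2) = p ^ (L ^ 2) := by
      rw [← zpow_add₀ hp0]; congr 1; ring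
    have e2 : p ^ (4 * L - 4) * p ^ ((L - 2) ^ 2) = p ^ (L ^ 2) := by
      rw [← zpow_add₀ hp0]; congr 1; ring
    rw [mul_add, ← mul_assoc, ← mul_assoc, ← mul_assoc, e1, e2]
    linear_combination p ^ (L ^ 2) * this
  · have := refinedTrinomial_zero_succ hp0 hp (L - 1 - M) M a
    push_cast
    rw [show L - (M + 1 : ℤ) = L - 1 - M by ring, show L - 1 - (M + 1 : ℤ) = L - 1 - M - 1 by ring,
      show L - 2 - (M + 1 : ℤ) = L - 1 - M - 2 by ring, show L - 2 - (M : ℤ) = L - 1 - M - 1 by ring]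
    set K := L - 1 - (M : ℤ) with hK
    have e1 : p ^ (2 * L - 1) * p ^ ((K - 1) ^ 2) = p ^ (K ^ 2) * (p ^ 2) ^ (M + 1) := by
      rw [← pow_mul, ← zpow_natCast, ← zpow_add₀ hp0, ← zpow_add₀ hp0]
      congr 1; push_cast; rw [hK]; ring
    have e2 : p ^ (4 * L - 4) * p ^ ((K - 2) ^ 2) = p ^ (K ^ 2) * (p ^ 2) ^ (2 * (M + 1)) := by
      rw [← pow_mul, ← zpow_natCast, ← zpow_add₀ hp0, ← zpow_add₀ hp0]
      congr 1; push_cast; rw [hK]; ring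
    have e3 : p ^ (2 * L - 2) * p ^ ((K - 1) ^ 2) = p ^ (K ^ 2) * p ^ (2 * M + 1) := by
      rw [← zpow_natCast, ← zpow_add₀ hp0, ← zpow_add₀ hp0]
      congr 1; push_cast; rw [hK]; ring
    rw [mul_add, ← mul_assoc, ← mul_assoc, ← mul_assoc, ← mul_assoc, e1, e2, e3]
    linear_combination p ^ (K ^ 2) * this
  · rw [refinedTrinomial_of_lt p (N - 1) 0
        (lt_of_lt_of_le (by omega) (abs_nonneg a) : L - 1 - ((N - 1 : ℕ) : ℤ) < |a|),
      refinedTrinomial_of_lt p (N - 1) 0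
        (lt_of_lt_of_le (by omega) (abs_nonneg a) : L - 2 - ((N - 1 : ℕ) : ℤ) < |a|)]
    ring

/-- Along a diagonal, `refinedSum_succ_relation` sends level M+1 of diagonal L to level M of
diagonal L-1. -/
theorem diagonalSum_relation (hp0 : p ≠ 0) (hp : ‖p‖ < 1) {N : ℕ} {L : ℤ} {a : ℤ} (ha : 0 ≤ a)
    (b : ℕ) (hN : 0 < N) (h : L < N) :
    p * diagonalSum p N L a (b + 1) - (p ^ 2) ^ (b + 1) * diagonalSum p N L (a + 1) b =
      (1 - (p ^ 2) ^ L) * (p * diagonalSum p N (L - 1) a b -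
        (p ^ 2) ^ (b + 1) * diagonalSum p N (L - 1) (a + 1) (b + 1)) := by
  suffices key : p * diagonalSum p N L a (b + 1) - (p ^ 2) ^ (b + 1) * diagonalSum p N L (a + 1) b +
      (p ^ 2) ^ L * (p * diagonalSum p N (L - 1) a b -
        (p ^ 2) ^ (b + 1) * diagonalSum p N (L - 1) (a + 1) (b + 1)) =
      p * diagonalSum p N (L - 1) a b -
        (p ^ 2) ^ (b + 1) * diagonalSum p N (L - 1) (a + 1) (b + 1) by
    linear_combination key
  have hw (M : ℕ) : p * (p ^ ((L - M) ^ 2) * refinedTrinomial p (L - M) M a (b + 1)) -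
      (p ^ 2) ^ (b + 1) * (p ^ ((L - M) ^ 2) * refinedTrinomial p (L - M) M (a + 1) b) +
      (p ^ 2) ^ L * (p * (p ^ ((L - 1 - M) ^ 2) * refinedTrinomial p (L - 1 - M) M a b) -
        (p ^ 2) ^ (b + 1) *
          (p ^ ((L - 1 - M) ^ 2) * refinedTrinomial p (L - 1 - M) M (a + 1) (b + 1))) =
      p ^ ((L - M) ^ 2) * (p * refinedSum p (L - M) a M (M + b) (M - b - 1) -
        (p ^ 2) ^ (b + 1) * refinedSum p (L - M) (a + 1) M (M + b) (M - b - 1)) := by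
    rw [← refinedTrinomial_sub_left hp0 hp, ← refinedTrinomial_sub_right hp0 hp _ ha,
      show L - 1 - (M : ℤ) = L - M - 1 by ring]
    have e1 : (p ^ 2) ^ L * p ^ ((L - M - 1) ^ 2) * (p ^ 2) ^ (b + 1) =
        p ^ ((L - M) ^ 2) * p * (p ^ 2) ^ (M + b + 1) := by
      rw [← pow_mul, ← pow_mul, ← zpow_natCast p (2 * (b + 1)), ← zpow_natCast p 2, ← zpow_mul,
        ← zpow_natCast p (2 * (M + b + 1)), ← zpow_add₀ hp0, ← zpow_add₀ hp0, ← zpow_add_one₀ hp0,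
        ← zpow_add₀ hp0]
      congr 1; push_cast; ring
    have e2 : (p ^ 2) ^ L * p ^ ((L - M - 1) ^ 2) * p =
        p ^ ((L - M) ^ 2) * (p ^ 2) ^ (b + 1) * (p ^ 2) ^ ((M : ℤ) - b) := by
      rw [← pow_mul, ← zpow_natCast p (2 * (b + 1)), ← zpow_natCast p 2, ← zpow_mul, ← zpow_mul,
        ← zpow_add₀ hp0, ← zpow_add₀ hp0, ← zpow_add₀ hp0, ← zpow_add_one₀ hp0]
      congr 1; push_cast; ring
    linear_combination refinedTrinomial p (L - M - 1) M a b * e2 -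
      refinedTrinomial p (L - M - 1) M (a + 1) (b + 1) * e1
  simp only [diagonalSum, Finset.mul_sum, ← Finset.sum_add_distrib, ← Finset.sum_sub_distrib]
  refine sum_range_eq_of_succ hN ?_ (fun M => ?_) ?_
  · rw [hw, refinedSum_of_neg_right _ _ _ _ _ (by push_cast; omega),
      refinedSum_of_neg_right _ _ _ _ _ (by push_cast; omega)]
    ring
  · rw [hw, refinedSum_succ_relation hp0 hp _ ha, show L - ((M + 1 : ℕ) : ℤ) = L - 1 - M by
      push_cast; ring]
    ring
  · rw [refinedTrinomial_of_lt p (N - 1) b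
        (lt_of_lt_of_le (by omega) (abs_nonneg _) : L - 1 - ((N - 1 : ℕ) : ℤ) < |a|),
      refinedTrinomial_of_lt p (N - 1) (b + 1)
        (lt_of_lt_of_le (by omega) (abs_nonneg _) : L - 1 - ((N - 1 : ℕ) : ℤ) < |a + 1|)]
    ring

theorem diagonalSum_zero_eq (hp0 : p ≠ 0) (hp : ‖p‖ < 1) {N L : ℕ} (h : L < N) (a : ℤ) :
    diagonalSum p N L a 0 =
      p ^ (a ^ 2) * qPoch (p ^ 2) (p ^ 2) L * trinomialSum (p ^ 2) N L a := by
  have hq0 := pow_ne_zero 2 hp0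
  have hq := norm_sq_lt_one hp
  induction L using Nat.strong_induction_on generalizing a with
  | _ L ih =>
    have ih' (L' : ℤ) (hL' : L' < L) (a : ℤ) : diagonalSum p N L' a 0 =
        p ^ (a ^ 2) * qPoch (p ^ 2) (p ^ 2) L'.toNat * trinomialSum (p ^ 2) N L' a := by
      rcases lt_or_ge L' 0 with h0 | h0
      · rw [diagonalSum_of_lt _ _ _ (h0.trans_le (abs_nonneg a)),
          trinomialSum_of_lt _ _ (h0.trans_le (abs_nonneg a)), mul_zero]
      · lift L' to ℕ using h0
        exact ih L' (by omega) (by omega) a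
    rcases Nat.eq_zero_or_pos L with rfl | hL
    · by_cases ha : a = 0
      · subst ha
        rw [diagonalSum, trinomialSum, Finset.sum_eq_single_of_mem 0 (by simpa using h),
          Finset.sum_eq_single_of_mem 0 (by simpa using h)]
        · simp [refinedTrinomial, refinedSum, evenBinom, qBinom_self hq, qPochRecip, qPoch]
        · intro n _ hn
          rw [qPochRecip_of_neg _ (by omega : ((0 : ℕ) : ℤ) - 2 * n - 0 < 0)]
          ring
        · intro n _ hn
          rw [refinedTrinomial_of_lt _ _ _ (by rw [abs_zero]; omega), mul_zero]
      · have : ((0 : ℕ) : ℤ) < |a| := by simpa using ha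
        rw [diagonalSum_of_lt _ _ _ this, trinomialSum_of_lt _ _ this, mul_zero]
    · have h1 := diagonalSum_zero_recurrence hp0 hp a (N := N) (L := L) (by omega) (by omega)
      have h2 := trinomialSum_recurrence hq0 hq a (by omega : (L : ℤ) < N)
      rw [ih' (L - 1) (by omega), ih' (L - 1) (by omega), ih' (L - 1) (by omega),
        ih' (L - 2) (by omega)] at h1
      have h3 : qPoch (p ^ 2) (p ^ 2) L =
          qPoch (p ^ 2) (p ^ 2) ((L : ℤ) - 1).toNat * (1 - (p ^ 2) ^ (L : ℤ)) := by
        rw [← qPoch_self_toNat _ (by omega), Int.toNat_natCast]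
      -- For L = 1 the Pochhammer step is unavailable, but the trinomial sum at L - 2 = -1 is zero.
      have h4 : (1 - (p ^ 2) ^ ((L : ℤ) - 1)) * (qPoch (p ^ 2) (p ^ 2) ((L : ℤ) - 2).toNat *
          trinomialSum (p ^ 2) N (L - 2) a) =
          qPoch (p ^ 2) (p ^ 2) ((L : ℤ) - 1).toNat * trinomialSum (p ^ 2) N (L - 2) a := by
        rcases eq_or_lt_of_le (Nat.succ_le_of_lt hL) with h | h
        · rw [trinomialSum_of_lt _ _ ((by omega : (L : ℤ) - 2 < 0).trans_le (abs_nonneg a))]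
          ring
        · rw [qPoch_self_toNat _ (by omega : 1 ≤ (L : ℤ) - 1),
            show (L : ℤ) - 1 - 1 = L - 2 by ring]
          ring
      have e1 : p ^ (2 * (L : ℤ) - 1) * p ^ ((a + 1) ^ 2) =
          p ^ (a ^ 2) * (p ^ 2) ^ ((L : ℤ) + a) := by
        rw [← zpow_natCast p 2, ← zpow_mul, ← zpow_add₀ hp0, ← zpow_add₀ hp0]
        congr 1; push_cast; ring
      have e2 : p ^ (2 * (L : ℤ) - 1) * p ^ ((a - 1) ^ 2) =
          p ^ (a ^ 2) * (p ^ 2) ^ ((L : ℤ) - a) := by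
        rw [← zpow_natCast p 2, ← zpow_mul, ← zpow_add₀ hp0, ← zpow_add₀ hp0]
        congr 1; push_cast; ring
      have e3 : p ^ (2 * (L : ℤ) - 2) = (p ^ 2) ^ ((L : ℤ) - 1) := by
        rw [← zpow_natCast p 2, ← zpow_mul]
        congr 1; push_cast; ring
      have e4 : p ^ (4 * (L : ℤ) - 4) = (p ^ 2) ^ ((L : ℤ) - 1) * (p ^ 2) ^ ((L : ℤ) - 1) := by
        rw [← zpow_natCast p 2, ← zpow_mul, ← zpow_add₀ hp0]
        congr 1; push_cast; ring
      rw [e3, e4] at h1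
      rw [h3]
      linear_combination h1 +
        p ^ (a ^ 2) * qPoch (p ^ 2) (p ^ 2) ((L : ℤ) - 1).toNat * -h2 +
        p ^ (a ^ 2) * (p ^ 2) ^ ((L : ℤ) - 1) * h4 +
        qPoch (p ^ 2) (p ^ 2) ((L : ℤ) - 1).toNat * trinomialSum (p ^ 2) N (L - 1) (a + 1) * e1 +
        qPoch (p ^ 2) (p ^ 2) ((L : ℤ) - 1).toNat * trinomialSum (p ^ 2) N (L - 1) (a - 1) * e2

theorem diagonalSum_neg (p : ℂ) (N : ℕ) (L a b : ℤ) :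
    diagonalSum p N L (-a) (-b) = diagonalSum p N L a b := by
  simp only [diagonalSum, refinedTrinomial_neg]

/-- Inherited from the symmetry (a, b) ↦ (-a, -b) of the refined trinomial through the evaluation at
b = 0. -/
theorem trinomialSum_neg (hp0 : p ≠ 0) (hp : ‖p‖ < 1) {N L : ℕ} (h : L < N) (a : ℤ) :
    trinomialSum (p ^ 2) N L (-a) = trinomialSum (p ^ 2) N L a := by
  have h1 := diagonalSum_zero_eq hp0 hp h (-a)
  have h2 := diagonalSum_neg p N L a 0
  rw [neg_zero, h1, diagonalSum_zero_eq hp0 hp h a, neg_sq] at h2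
  exact mul_left_cancel₀ (mul_ne_zero (zpow_ne_zero _ hp0)
    (qPoch_self_ne_zero (norm_sq_lt_one hp) L)) h2

theorem diagonalSum_eq_of_nonneg (hp0 : p ≠ 0) (hp : ‖p‖ < 1) {N L : ℕ} (h : L < N) {a : ℤ}
    (ha : 0 ≤ a) (b : ℕ) :
    diagonalSum p N L a b =
      p ^ (a ^ 2) * qPoch (p ^ 2) (p ^ 2) L * trinomialSum (p ^ 2) N L (a + b) := by
  have hq0 := pow_ne_zero 2 hp0
  have hq := norm_sq_lt_one hp
  induction b generalizing a L with
  | zero => simpa using diagonalSum_zero_eq hp0 hp h a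
  | succ b ihb =>
    induction L generalizing a with
    | zero =>
      rw [trinomialSum_of_lt _ _ (lt_of_lt_of_le (by push_cast; omega) (le_abs_self _)), mul_zero]
      refine Finset.sum_eq_zero fun M _ => ?_
      cases M with
      | zero =>
        rw [refinedTrinomial_of_lt_abs _ _ _
          (lt_of_lt_of_le (by push_cast; omega) (le_abs_self _)), mul_zero]
      | succ M =>
        rw [refinedTrinomial_of_lt _ _ _ (lt_of_lt_of_le (by push_cast; omega) (le_abs_self _)),
          mul_zero]
    | succ L ih =>
      have h1 := diagonalSum_relation hp0 hp ha b (by omega) (by omega : ((L + 1 : ℕ) : ℤ) < N)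
      have h2 := trinomialSum_relation hq0 hq (a + b + 1) (by omega : ((L + 1 : ℕ) : ℤ) < N)
      have hL : ((L + 1 : ℕ) : ℤ) - 1 = L := by push_cast; ring
      have h3 := qPoch_self_succ (p ^ 2) L
      have ih' := ih (by omega) (a := a + 1) (by omega)
      have i1 := ihb h (a := a + 1) (by omega)
      have i2 := ihb (L := L) (by omega) ha
      rw [hL] at h1 h2
      rw [← Nat.cast_add_one, ih', i1, i2, zpow_natCast] at h1
      push_cast at h1 h2 ⊢
      rw [add_sub_cancel_right] at h2
      rw [show a + 1 + (b : ℤ) = a + b + 1 by ring,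
        show a + 1 + ((b : ℤ) + 1) = a + b + 1 + 1 by ring] at h1
      rw [← add_assoc a (b : ℤ) 1]
      have e1 : p ^ ((a + 1) ^ 2) * (p ^ 2) ^ (b + 1) =
          p ^ (a ^ 2) * p * (p ^ 2) ^ (a + b + 1) := by
        rw [← pow_mul, ← zpow_natCast, ← zpow_natCast p 2, ← zpow_mul, ← zpow_add₀ hp0,
          ← zpow_add_one₀ hp0, ← zpow_add₀ hp0]
        congr 1; push_cast; ring
      refine mul_left_cancel₀ hp0 ?_
      rw [h3] at h1 ⊢
      linear_combination h1 + p ^ (a ^ 2) * p * qPoch (p ^ 2) (p ^ 2) L *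
        (1 - (p ^ 2) ^ (L + 1)) * -h2 + qPoch (p ^ 2) (p ^ 2) L * (1 - (p ^ 2) ^ (L + 1)) *
        (trinomialSum (p ^ 2) N (L + 1) (a + b + 1) -
          trinomialSum (p ^ 2) N L (a + b + 1 + 1)) * e1

theorem diagonalSum_eq (hp0 : p ≠ 0) (hp : ‖p‖ < 1) {N L : ℕ} (h : L < N) (k : ℕ) (j : ℤ) :
    diagonalSum p N L (k * j) j =
      p ^ ((k * j) ^ 2) * qPoch (p ^ 2) (p ^ 2) L * trinomialSum (p ^ 2) N L ((k + 1) * j) := by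
  rcases le_total 0 j with hj | hj
  · lift j to ℕ using hj
    rw [diagonalSum_eq_of_nonneg hp0 hp h (by positivity), add_one_mul]
  · obtain ⟨i, rfl⟩ : ∃ i : ℕ, j = -i := ⟨(-j).toNat, by omega⟩
    rw [mul_neg, mul_neg, diagonalSum_neg, trinomialSum_neg hp0 hp h, neg_sq,
      diagonalSum_eq_of_nonneg hp0 hp h (by positivity), add_one_mul]

end DiagonalSum

/-! ### The `q`-Pfaff–Saalschütz summation. -/

section Saalschutz

variable {q : ℂ}

/-- The left-hand side of the `q`-Pfaff-Saalschütz summation for `q`-binomial coefficients. -/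
noncomputable def saalschutzSum (q : ℂ) (A : ℤ) (C : ℕ) (r s : ℤ) : ℂ :=
  ∑ b ∈ Finset.range (C + 1), q ^ ((b : ℤ) * (b + s - r)) * qBinom q A (b + s - r) *
    qBinom q C b * qBinom q (A + C + r - b) (A + C)

theorem saalschutzSum_recurrence (hq0 : q ≠ 0) (hq : ‖q‖ < 1) {A : ℤ} (hA : 0 < A) (C : ℕ)
    (r s : ℤ) :
    saalschutzSum q A C r s - q ^ (A + C) * saalschutzSum q A C (r - 1) (s - 1) =
      saalschutzSum q (A - 1) C r s + q ^ (A + r - s) * saalschutzSum q (A - 1) C r (s - 1) := by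
  simp only [saalschutzSum, Finset.mul_sum, ← Finset.sum_sub_distrib, ← Finset.sum_add_distrib]
  refine Finset.sum_congr rfl fun b _ => ?_
  rw [show (b : ℤ) + (s - 1) - (r - 1) = b + s - r by ring,
    show A + (C : ℤ) + (r - 1) - b = A + C + r - b - 1 by ring,
    show A - 1 + (C : ℤ) + r - b = A + C + r - b - 1 by ring,
    show A - 1 + (C : ℤ) = A + C - 1 by ring,
    show (b : ℤ) + (s - 1) - r = b + s - r - 1 by ring,
    qBinom_pascal' hq0 hq (a := A + C + r - b) (by omega),
    qBinom_pascal hq0 hq (a := A) (Or.inl hA.ne')]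
  have e : q ^ (A + r - s) * q ^ ((b : ℤ) * (b + s - r - 1)) =
      q ^ ((b : ℤ) * (b + s - r)) * q ^ (A - (b + s - r)) := by
    rw [← zpow_add₀ hq0, ← zpow_add₀ hq0]; congr 1; ring
  linear_combination (qBinom q (A - 1) (b + s - r - 1) * qBinom q C b *
    qBinom q (A + C + r - b - 1) (A + C - 1)) * -e

theorem qBinom_mul_recurrence (hq0 : q ≠ 0) (hq : ‖q‖ < 1) {A r : ℤ} (hA : 0 < A) (hr : 0 ≤ r)
    (C : ℕ) (s : ℤ) :
    qBinom q (A + r) s * qBinom q (C + s) r -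
        q ^ (A + C) * (qBinom q (A + (r - 1)) (s - 1) * qBinom q (C + (s - 1)) (r - 1)) =
      qBinom q (A - 1 + r) s * qBinom q (C + s) r +
        q ^ (A + r - s) * (qBinom q (A - 1 + r) (s - 1) * qBinom q (C + (s - 1)) r) := by
  have e1 := qBinom_pascal hq0 hq (a := A + r) (b := s) (Or.inl (by omega))
  have e2 : qBinom q (A + r - 1) (s - 1) * (qBinom q (C + s) r - qBinom q (C + s - 1) r -
      q ^ (C + s - r) * qBinom q (C + s - 1) (r - 1)) = 0 := by
    by_cases h : (C : ℤ) + s ≠ 0 ∨ r ≠ 0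
    · rw [qBinom_pascal hq0 hq h]; ring
    · rw [qBinom_of_neg q (by omega : s - 1 < 0)]; ring
  have e3 : q ^ (A + C) = q ^ (A + r - s) * q ^ (C + s - r) := by
    rw [← zpow_add₀ hq0]; congr 1; ring
  rw [show A + (r - 1) = A + r - 1 by ring, show A - 1 + r = A + r - 1 by ring, ← add_sub_assoc,
    e1, e3]
  linear_combination q ^ (A + r - s) * e2

theorem qPoch_mul_qPochRecip (hq : ‖q‖ < 1) {a : ℤ} (ha : 0 ≤ a) :
    qPoch q q a.toNat * qPochRecip q a = 1 := by
  rw [qPochRecip, if_pos ha, mul_one_div_cancel (qPoch_self_ne_zero hq _)]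

/-- The factor [0, b+s-r] leaves only the term b = r - s. -/
theorem saalschutzSum_zero (hq : ‖q‖ < 1) (C : ℕ) {r : ℤ} (hr : 0 ≤ r) (s : ℤ) :
    saalschutzSum q 0 C r s = qBinom q r s * qBinom q (C + s) r := by
  by_cases h : 0 ≤ r - s ∧ r - s ≤ C
  · rw [saalschutzSum, Finset.sum_eq_single_of_mem (r - s).toNat (by simp; omega)]
    · rw [Int.toNat_of_nonneg h.1, show r - s + s - r = 0 by ring, mul_zero, zpow_zero,
        qBinom_self hq le_rfl, zero_add, show (C : ℤ) + r - (r - s) = C + s by ring, qBinom_eq,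
        qBinom_eq, qBinom_eq, qBinom_eq, show (C : ℤ) + s - C = s by ring,
        show (C : ℤ) + s - r = C - (r - s) by ring]
      linear_combination qPochRecip q (r - s) * qPochRecip q (C - (r - s)) *
        qPoch q q (C + s).toNat * qPochRecip q s *
        (qPoch_mul_qPochRecip hq (Int.natCast_nonneg C) - qPoch_mul_qPochRecip hq hr)
    · intro b _ hb
      rcases lt_or_ge 0 ((b : ℤ) + s - r) with h1 | h1
      · rw [qBinom_of_lt q h1]; ring
      · rw [qBinom_of_neg q (by omega : (b : ℤ) + s - r < 0)]; ring
  · have : qBinom q r s * qBinom q (C + s) r = 0 := by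
      rcases lt_or_ge (r - s) 0 with h1 | h1
      · rw [qBinom_of_lt q (by omega : r < s), zero_mul]
      · rw [qBinom_of_lt q (by omega : (C : ℤ) + s < r), mul_zero]
    rw [this]
    refine Finset.sum_eq_zero fun b hb => ?_
    have := Finset.mem_range.mp hb
    rcases lt_or_ge 0 ((b : ℤ) + s - r) with h1 | h1
    · rw [qBinom_of_lt q h1]; ring
    · rw [qBinom_of_neg q (by omega : (b : ℤ) + s - r < 0)]; ring

/-- Both sides obey one recurrence, which lowers A or else r and s together. It ends at A = 0 or at
r < 0, where both sides vanish. -/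
theorem saalschutzSum_eq (hq0 : q ≠ 0) (hq : ‖q‖ < 1) (A C : ℕ) (r s : ℤ) :
    saalschutzSum q A C r s = qBinom q (A + r) s * qBinom q (C + s) r := by
  have hneg (A : ℕ) {r : ℤ} (hr : r < 0) (s : ℤ) :
      saalschutzSum q A C r s = qBinom q (A + r) s * qBinom q (C + s) r := by
    rw [qBinom_of_neg q hr, mul_zero]
    exact Finset.sum_eq_zero fun b _ => by
      rw [qBinom_of_lt q (by omega : (A : ℤ) + C + r - b < A + C), mul_zero]
  induction A generalizing r s with
  | zero =>
    rcases lt_or_ge r 0 with hr | hr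
    · exact hneg _ hr s
    · simpa using saalschutzSum_zero hq C hr s
  | succ A ih =>
    rcases lt_or_ge r 0 with hr | hr
    · exact hneg _ hr s
    lift r to ℕ using hr
    induction r generalizing s with
    | zero =>
      have h1 := saalschutzSum_recurrence hq0 hq (A := (A + 1 : ℕ)) (by omega) C 0 s
      have h2 := qBinom_mul_recurrence hq0 hq (A := (A + 1 : ℕ)) (by omega) le_rfl C s
      rw [hneg (A + 1) (by omega : (0 : ℤ) - 1 < 0)] at h1
      rw [show ((A + 1 : ℕ) : ℤ) - 1 = A by push_cast; ring, ih, ih] at h1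
      rw [show ((A + 1 : ℕ) : ℤ) - 1 = A by push_cast; ring] at h2
      rw [Nat.cast_zero]
      linear_combination h1 - h2
    | succ r ihr =>
      have h1 := saalschutzSum_recurrence hq0 hq (A := (A + 1 : ℕ)) (by omega) C (r + 1 : ℕ) s
      have h2 := qBinom_mul_recurrence hq0 hq (A := (A + 1 : ℕ)) (r := (r + 1 : ℕ)) (by omega)
        (by omega) C s
      rw [show ((r + 1 : ℕ) : ℤ) - 1 = r by push_cast; ring, ihr] at h1
      rw [show ((A + 1 : ℕ) : ℤ) - 1 = A by push_cast; ring, ih, ih] at h1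
      rw [show ((A + 1 : ℕ) : ℤ) - 1 = A by push_cast; ring,
        show ((r + 1 : ℕ) : ℤ) - 1 = r by push_cast; ring] at h2
      linear_combination h1 - h2

/-- Saalschütz with A = C = M, k = j + 2r and s = r + j; if k - j is odd, both sides are zero. -/
theorem evenBinom_mul_evenBinom {p : ℂ} (hp0 : p ≠ 0) (hp : ‖p‖ < 1) (M : ℕ) (k j : ℤ) :
    p ^ (j ^ 2) * (evenBinom (p ^ 2) (k - j) (M + j) * evenBinom (p ^ 2) (k + j) (M - j)) =
      ∑ b ∈ Finset.range (M + 1), p ^ ((b + j) ^ 2 + (b : ℤ) ^ 2) * qBinom (p ^ 2) M (b + j) *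
        qBinom (p ^ 2) M b * evenBinom (p ^ 2) (k - 2 * b - j) (2 * M) := by
  by_cases h : Even (k - j)
  · obtain ⟨r, hr⟩ := h
    obtain rfl : k = j + r + r := by omega
    have hs := saalschutzSum_eq (pow_ne_zero 2 hp0) (norm_sq_lt_one hp) M M r (r + j)
    have e1 : evenBinom (p ^ 2) (j + r + r - j) (M + j) = qBinom (p ^ 2) (M + (r + j)) r := by
      rw [evenBinom, if_pos ⟨r, by ring⟩, qBinom_symm,
        show (j + r + r - j) / 2 = r by omega]
      congr 1 <;> ring
    have e2 : evenBinom (p ^ 2) (j + r + r + j) (M - j) = qBinom (p ^ 2) (M + r) (r + j) := by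
      rw [evenBinom, if_pos ⟨r + j, by ring⟩, qBinom_symm,
        show (j + r + r + j) / 2 = r + j by omega]
      congr 1 <;> ring
    rw [e1, e2, mul_comm (qBinom _ _ _), ← hs, saalschutzSum, Finset.mul_sum]
    refine Finset.sum_congr rfl fun b _ => ?_
    rw [evenBinom, if_pos ⟨r - b, by ring⟩, show (j + r + r - 2 * (b : ℤ) - j) / 2 = r - b by omega,
      show (b : ℤ) + (r + j) - r = b + j by ring, show (M : ℤ) + M + r - b = 2 * M + (r - b) by ring,
      show (M : ℤ) + M = 2 * M by ring]
    have e3 : p ^ (((b : ℤ) + j) ^ 2 + (b : ℤ) ^ 2) =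
        p ^ (j ^ 2) * (p ^ 2) ^ ((b : ℤ) * (b + j)) := by
      rw [← zpow_natCast p 2, ← zpow_mul, ← zpow_add₀ hp0]; congr 1; push_cast; ring
    rw [e3]; ring
  · rw [evenBinom, if_neg h, zero_mul, mul_zero]
    refine (Finset.sum_eq_zero fun b _ => ?_).symm
    rw [evenBinom, if_neg, mul_zero]
    intro h'
    obtain ⟨r, hr⟩ := h'
    exact h ⟨r + b, by omega⟩

end Saalschutz

/-! ### The seed identity for the sum over m. -/

/-- The functional `f ↦ Σ_n p^(n²) y^n [M, n] f(n)`. -/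
noncomputable def qBinomSum (p y : ℂ) (M : ℕ) (f : ℕ → ℂ) : ℂ :=
  ∑ n ∈ Finset.range (M + 1), p ^ (n ^ 2) * qBinom (p ^ 2) M n * (y ^ n * f n)

/-- The threefold iterate of `qBinomSum` at the arguments `x`, `x⁻¹` and `1`. -/
noncomputable def qBinomTripleSum (p x : ℂ) (A B C : ℕ) (f : ℕ → ℂ) : ℂ :=
  qBinomSum p x A fun a => qBinomSum p x⁻¹ B fun b => qBinomSum p 1 C fun n => f (a + b + n)

section Seed

variable {p : ℂ}

theorem qBinomSum_succ (hp0 : p ≠ 0) (hp : ‖p‖ < 1) (y : ℂ) (M : ℕ) (f : ℕ → ℂ) :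
    qBinomSum p y (M + 1) f =
      qBinomSum p y M f + y * p ^ (2 * M + 1) * qBinomSum p y M fun n => f (n + 1) := by
  rw [qBinomSum, sum_qBinom_succ hp0 hp, qBinomSum, qBinomSum, mul_comm y, mul_assoc,
    Finset.mul_sum _ _ y]
  congr 2
  exact Finset.sum_congr rfl fun n _ => by ring

theorem qBinomSum_add_mul (p y : ℂ) (M : ℕ) (c : ℂ) (f g : ℕ → ℂ) :
    (qBinomSum p y M fun n => f n + c * g n) = qBinomSum p y M f + c * qBinomSum p y M g := by
  rw [qBinomSum, qBinomSum, qBinomSum, Finset.mul_sum, ← Finset.sum_add_distrib]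
  exact Finset.sum_congr rfl fun n _ => by ring

theorem qBinomTripleSum_succ_left (hp0 : p ≠ 0) (hp : ‖p‖ < 1) (x : ℂ) (A B C : ℕ) (f : ℕ → ℂ) :
    qBinomTripleSum p x (A + 1) B C f = qBinomTripleSum p x A B C f +
      x * p ^ (2 * A + 1) * qBinomTripleSum p x A B C fun n => f (n + 1) := by
  simp only [qBinomTripleSum, qBinomSum_succ hp0 hp, add_right_comm _ 1]

theorem qBinomTripleSum_succ_middle (hp0 : p ≠ 0) (hp : ‖p‖ < 1) (x : ℂ) (A B C : ℕ)
    (f : ℕ → ℂ) :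
    qBinomTripleSum p x A (B + 1) C f = qBinomTripleSum p x A B C f +
      x⁻¹ * p ^ (2 * B + 1) * qBinomTripleSum p x A B C fun n => f (n + 1) := by
  simp only [qBinomTripleSum, qBinomSum_succ hp0 hp, qBinomSum_add_mul, ← add_assoc,
    add_right_comm _ 1]

theorem qBinomTripleSum_succ_right (hp0 : p ≠ 0) (hp : ‖p‖ < 1) (x : ℂ) (A B C : ℕ)
    (f : ℕ → ℂ) :
    qBinomTripleSum p x A B (C + 1) f = qBinomTripleSum p x A B C f +
      p ^ (2 * C + 1) * qBinomTripleSum p x A B C fun n => f (n + 1) := by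
  simp only [qBinomTripleSum, qBinomSum_succ hp0 hp, qBinomSum_add_mul, ← add_assoc, one_mul]

/-- Let z be the shift of f, so that the functional is ∏_(k<M) (1 + y z p^(2k+1)). In the product
for 3M the exponents 6k+1, 6k+3, 6k+5 are those of P^(2k+1), P = p³, times p⁻², 1 and p². -/
theorem qBinomSum_three_mul (hp0 : p ≠ 0) (hp : ‖p‖ < 1) (M : ℕ) (f : ℕ → ℂ) :
    qBinomSum p 1 (3 * M) f = qBinomTripleSum (p ^ 3) (p ^ 2) M M M f := by
  have hp30 := pow_ne_zero 3 hp0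
  have hp3 : ‖p ^ 3‖ < 1 := by
    rw [norm_pow]; exact pow_lt_one₀ (norm_nonneg _) hp three_ne_zero
  have h1 {p : ℂ} (hp : ‖p‖ < 1) : qBinom (p ^ 2) 0 0 = 1 := by
    rw [qBinom_self (norm_sq_lt_one hp) le_rfl]
  induction M generalizing f with
  | zero => simp [qBinomSum, qBinomTripleSum, h1 hp, h1 hp3]
  | succ M ih =>
    rw [show 3 * (M + 1) = 3 * M + 1 + 1 + 1 by ring]
    simp only [qBinomSum_succ hp0 hp, ih, qBinomTripleSum_succ_left hp30 hp3,
      qBinomTripleSum_succ_middle hp30 hp3, qBinomTripleSum_succ_right hp30 hp3]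
    have e : (p ^ 2)⁻¹ * (p ^ 3) ^ (2 * M + 1) = p ^ (2 * (3 * M) + 1) := by
      field_simp
      ring
    rw [e]
    ring

theorem sum_Icc_shift (G : ℤ → ℂ) {M J b : ℕ} (hb : b ≤ M) (hM : M ≤ J) (h0 : ∀ z < 0, G z = 0)
    (h1 : ∀ z : ℤ, M < z → G z = 0) :
    ∑ a ∈ Finset.range (M + 1), G a = ∑ j ∈ Finset.Icc (-J : ℤ) J, G (b + j) := by
  refine Finset.sum_of_injOn (fun a : ℕ => (a : ℤ) - b) ?_ ?_ ?_ ?_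
  · intro a _ a' _ h
    simpa using h
  · intro a ha
    simp only [Finset.coe_range, Set.mem_Iio, Finset.coe_Icc, Set.mem_Icc] at ha ⊢
    omega
  · intro j _ hj
    rcases lt_or_ge ((b : ℤ) + j) 0 with h | h
    · exact h0 _ h
    · refine h1 _ (not_le.mp fun h' => hj ⟨((b : ℤ) + j).toNat, ?_, ?_⟩)
      · simp only [Finset.coe_range, Set.mem_Iio]
        omega
      · simp only []
        omega
  · intro a _
    rw [add_sub_cancel]

/-- Collect the terms of the sums at x and x⁻¹ by j = a - b. The sum over b in the coefficient of
x^j is the one that `evenBinom_mul_evenBinom` evaluates as a product. -/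
theorem qBinomTripleSum_evenBinom (hp0 : p ≠ 0) (hp : ‖p‖ < 1) {x : ℂ} (hx : x ≠ 0) {M J : ℕ}
    (hM : M ≤ J) (K : ℤ) :
    (qBinomTripleSum p x M M M fun m => evenBinom (p ^ 2) (K - m) (2 * M)) =
      ∑ j ∈ Finset.Icc (-J : ℤ) J, x ^ j * p ^ (j ^ 2) * refinedTrinomial p K M j j := by
  have h (j : ℤ) : x ^ j * p ^ (j ^ 2) * refinedTrinomial p K M j j =
      ∑ n ∈ Finset.range (M + 1), ∑ b ∈ Finset.range (M + 1),
        p ^ (n ^ 2) * qBinom (p ^ 2) M n * (x ^ j * (p ^ ((b + j) ^ 2 + (b : ℤ) ^ 2) *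
          qBinom (p ^ 2) M (b + j) * qBinom (p ^ 2) M b *
          evenBinom (p ^ 2) (K - n - 2 * b - j) (2 * M))) := by
    rw [refinedTrinomial, refinedSum, Finset.mul_sum]
    refine Finset.sum_congr rfl fun n _ => ?_
    rw [← Finset.mul_sum, ← Finset.mul_sum, ← evenBinom_mul_evenBinom hp0 hp]
    ring
  simp only [h]
  rw [Finset.sum_comm]
  simp only [Finset.sum_comm (s := Finset.Icc _ _)]
  have h' (n b : ℕ) (hb : b ∈ Finset.range (M + 1)) :
      ∑ j ∈ Finset.Icc (-J : ℤ) J, p ^ (n ^ 2) * qBinom (p ^ 2) M n *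
        (x ^ j * (p ^ ((b + j) ^ 2 + (b : ℤ) ^ 2) * qBinom (p ^ 2) M (b + j) *
          qBinom (p ^ 2) M b * evenBinom (p ^ 2) (K - n - 2 * b - j) (2 * M))) =
      ∑ a ∈ Finset.range (M + 1), p ^ (a ^ 2) * qBinom (p ^ 2) M a * (x ^ a *
        (p ^ (b ^ 2) * qBinom (p ^ 2) M b * (x⁻¹ ^ b * (p ^ (n ^ 2) * qBinom (p ^ 2) M n *
          (1 ^ n * evenBinom (p ^ 2) (K - (a + b + n : ℕ)) (2 * M)))))) := by
    have hs := sum_Icc_shift (fun z => p ^ (n ^ 2) * qBinom (p ^ 2) M n *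
        (x ^ (z - b) * (p ^ (z ^ 2 + (b : ℤ) ^ 2) * qBinom (p ^ 2) M z *
          qBinom (p ^ 2) M b * evenBinom (p ^ 2) (K - n - b - z) (2 * M))))
      (Nat.lt_succ_iff.mp (Finset.mem_range.mp hb)) hM
      (fun z hz => by rw [qBinom_of_neg _ hz]; ring)
      (fun z hz => by rw [qBinom_of_lt _ hz]; ring)
    simp only [add_sub_cancel_left] at hs
    refine Eq.trans (Finset.sum_congr rfl fun j _ => ?_) (hs.symm.trans
      (Finset.sum_congr rfl fun a _ => ?_))
    · rw [show K - n - b - (b + j) = K - (n : ℤ) - 2 * b - j by ring]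
    · push_cast
      rw [show K - (n : ℤ) - b - a = K - (a + b + n) by ring, zpow_sub₀ hx, zpow_add₀ hp0,
        zpow_natCast, zpow_natCast, ← Nat.cast_pow, ← Nat.cast_pow, zpow_natCast, zpow_natCast]
      simp only [inv_pow, one_pow]
      ring
  rw [Finset.sum_congr rfl fun n _ => Finset.sum_congr rfl (h' n)]
  simp only [qBinomTripleSum, qBinomSum, Finset.mul_sum]
  exact ((Finset.sum_congr rfl fun n _ => Finset.sum_comm).trans
    (Finset.sum_comm.trans (Finset.sum_congr rfl fun a _ => Finset.sum_comm))).symm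

end Seed

/-! ### Iterating the transform on the seed. -/

/-- The sum over `m` in the innermost position of the multisum. -/
noncomputable def innerSum (p : ℂ) (K : ℤ) (M : ℕ) : ℂ :=
  qBinomSum p 1 (3 * M) fun m => evenBinom ((p ^ 3) ^ 2) (K - m) (2 * M)

section Iterate

theorem refinedTransform_of_neg (p : ℂ) (F : ℤ → ℕ → ℂ) {K : ℤ} (hK : K < 0) (M : ℕ) :
    refinedTransform p F K M = 0 :=
  Finset.sum_eq_zero fun i _ => by rw [qBinom_of_neg _ hK]; ring

theorem refinedTrinomial_transform_mul {p : ℂ} (hp0 : p ≠ 0) (hp : ‖p‖ < 1) (K : ℤ) (M k : ℕ)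
    (j : ℤ) :
    refinedTransform p (fun K i => refinedTrinomial p K i (k * j) j) K M =
      p ^ (j ^ 2) * refinedTrinomial p K M ((k + 1) * j) j := by
  rcases lt_or_ge K 0 with hK | hK
  · rw [refinedTransform_of_neg _ _ hK, refinedTrinomial_of_lt _ _ _ (hK.trans_le (abs_nonneg _)),
      mul_zero]
  lift K to ℕ using hK
  rcases le_total 0 j with hj | hj
  · lift j to ℕ using hj
    rw [refinedTrinomial_transform hp0 hp K M (by positivity), add_one_mul]
    norm_cast
  · obtain ⟨i, rfl⟩ : ∃ i : ℕ, j = -i := ⟨(-j).toNat, by omega⟩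
    simp only [mul_neg, refinedTrinomial_neg, neg_sq]
    rw [refinedTrinomial_transform hp0 hp K M (by positivity), add_one_mul]
    norm_cast

/-- The window for j depends on J alone, so it serves every level i ≤ M inside the transform and the
two sums can be exchanged. -/
theorem refinedTransform_iterate_innerSum {p : ℂ} (hp0 : p ≠ 0) (hp : ‖p‖ < 1) (k : ℕ) {M J : ℕ}
    (hM : M ≤ J) (K : ℤ) :
    (refinedTransform (p ^ 3))^[k] (innerSum p) K M = ∑ j ∈ Finset.Icc (-J : ℤ) J,
      (p ^ 2) ^ j * (p ^ 3) ^ ((k + 1) * j ^ 2) * refinedTrinomial (p ^ 3) K M ((k + 1) * j) j := by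
  have hp30 := pow_ne_zero 3 hp0
  have hp3 : ‖p ^ 3‖ < 1 := by
    rw [norm_pow]; exact pow_lt_one₀ (norm_nonneg _) hp three_ne_zero
  induction k generalizing K M with
  | zero =>
    rw [Function.iterate_zero, id, innerSum, qBinomSum_three_mul hp0 hp,
      qBinomTripleSum_evenBinom hp30 hp3 (pow_ne_zero 2 hp0) hM]
    simp
  | succ k ih =>
    have h (j : ℤ) : (p ^ 2) ^ j * (p ^ 3) ^ (((k + 1 : ℕ) + 1) * j ^ 2) *
        refinedTrinomial (p ^ 3) K M (((k + 1 : ℕ) + 1) * j) j =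
        (p ^ 2) ^ j * (p ^ 3) ^ ((k + 1) * j ^ 2) * refinedTransform (p ^ 3)
          (fun K i => refinedTrinomial (p ^ 3) K i ((k + 1) * j) j) K M := by
      have h1 := refinedTrinomial_transform_mul hp30 hp3 K M (k + 1) j
      push_cast at h1 ⊢
      rw [h1, add_one_mul _ (j ^ 2), zpow_add₀ hp30]
      ring
    rw [Function.iterate_succ_apply', refinedTransform, Finset.sum_congr rfl fun j _ => h j]
    simp only [refinedTransform, Finset.mul_sum]
    rw [Finset.sum_comm]
    refine Finset.sum_congr rfl fun i hi => ?_
    rw [ih (by have := Finset.mem_range.mp hi; omega), Finset.mul_sum]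
    exact Finset.sum_congr rfl fun j _ => by ring

end Iterate

/-! ### The trinomial side as a diagonal sum. -/

section Trinomial

theorem roundTrinomial_self (q : ℂ) (L : ℕ) (c : ℤ) :
    roundTrinomial q L c c = qPoch q q L * trinomialSum q (L + 1) L c := by
  rw [roundTrinomial, tsum_eq_sum (s := Finset.range (L + 1)), trinomialSum, Finset.mul_sum]
  · exact Finset.sum_congr rfl fun n _ => by ring
  · intro n hn
    rw [Finset.mem_range] at hn
    rcases lt_or_ge ((n : ℤ) + c) 0 with h | h
    · rw [qPochRecip_of_neg q h]; ring
    · rw [qPochRecip_of_neg q (by omega : (L : ℤ) - 2 * n - c < 0)]; ring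

theorem trinomialTerm_of_notMem (q : ℂ) (L ν : ℕ) {j : ℤ} (hj : j ∉ Finset.Icc (-L : ℤ) L) :
    trinomialTerm q L ν j = 0 := by
  rw [trinomialTerm, roundTrinomial_self, trinomialSum_of_lt, mul_zero, mul_zero]
  rw [Finset.mem_Icc, ← abs_le, not_le] at hj
  rw [abs_mul]
  have : (1 : ℤ) ≤ |(ν : ℤ) + 2| := by rw [abs_of_nonneg] <;> omega
  nlinarith [abs_nonneg j]

theorem hasSum_trinomialTerm (q : ℂ) (L ν : ℕ) :
    HasSum (trinomialTerm q L ν) (∑ j ∈ Finset.Icc (-L : ℤ) L, trinomialTerm q L ν j) :=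
  hasSum_sum_of_ne_finset_zero fun _ hj => trinomialTerm_of_notMem q L ν hj

theorem sum_trinomialTerm {p : ℂ} (hp0 : p ≠ 0) (hp : ‖p‖ < 1) (L ν : ℕ) :
    ∑ j ∈ Finset.Icc (-L : ℤ) L, trinomialTerm (p ^ 2) L ν j =
      ∑ i ∈ Finset.range (L + 1),
        (p ^ 3) ^ (i ^ 2) * (refinedTransform (p ^ 3))^[ν] (innerSum p) i (L - i) := by
  have hp30 := pow_ne_zero 3 hp0
  have hp3 : ‖p ^ 3‖ < 1 := by
    rw [norm_pow]; exact pow_lt_one₀ (norm_nonneg _) hp three_ne_zero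
  have h (j : ℤ) : trinomialTerm (p ^ 2) L ν j = (p ^ 2) ^ j * (p ^ 3) ^ ((ν + 1) * j ^ 2) *
      diagonalSum (p ^ 3) (L + 1) L ((ν + 1) * j) j := by
    have h1 := diagonalSum_eq hp30 hp3 (Nat.lt_succ_self L) (ν + 1) j
    push_cast at h1
    rw [h1, trinomialTerm, roundTrinomial_self, show (p ^ 2) ^ 3 = (p ^ 3) ^ 2 by ring,
      show (ν : ℤ) + 1 + 1 = ν + 2 by ring]
    have h2 : ((ν + 2).choose 2 : ℤ) * 2 = (ν + 2) * (ν + 1) := by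
      have := Nat.choose_two_right (ν + 2)
      have h3 := Nat.even_mul_pred_self (ν + 2)
      rw [this]
      have := Nat.div_mul_cancel h3.two_dvd
      push_cast at *
      exact_mod_cast this
    -- The exponents combine because (ν+1) + (ν+1)² = (ν+1)(ν+2).
    have h3 : (p ^ 2) ^ (3 * ((ν + 2).choose 2 : ℤ) * j ^ 2 + j) =
        (p ^ 2) ^ j * (p ^ 3) ^ (((ν : ℤ) + 1) * j ^ 2) * (p ^ 3) ^ ((((ν : ℤ) + 1) * j) ^ 2) := by
      rw [← zpow_natCast p 2, ← zpow_natCast p 3, ← zpow_mul, ← zpow_mul, ← zpow_mul, ← zpow_mul,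
        ← zpow_add₀ hp0, ← zpow_add₀ hp0]
      congr 1
      push_cast
      linear_combination 3 * j ^ 2 * h2
    rw [h3]
    ring
  have h4 (i : ℕ) (hi : i ∈ Finset.range (L + 1)) :
      (p ^ 3) ^ (i ^ 2) * (refinedTransform (p ^ 3))^[ν] (innerSum p) i (L - i) =
        ∑ j ∈ Finset.Icc (-L : ℤ) L, (p ^ 2) ^ j * (p ^ 3) ^ ((ν + 1) * j ^ 2) *
          ((p ^ 3) ^ (i ^ 2) * refinedTrinomial (p ^ 3) i (L - i) ((ν + 1) * j) j) := by
    rw [refinedTransform_iterate_innerSum hp0 hp ν (Nat.sub_le L i), Finset.mul_sum]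
    exact Finset.sum_congr rfl fun j _ => by ring
  rw [Finset.sum_congr rfl h4, Finset.sum_comm]
  refine Finset.sum_congr rfl fun j _ => ?_
  rw [h, diagonalSum, Finset.mul_sum, ← Finset.sum_range_reflect]
  refine Finset.sum_congr rfl fun i hi => ?_
  have hi' := Finset.mem_range.mp hi
  rw [show L + 1 - 1 - i = L - i by omega,
    show (L : ℤ) - ((L - i : ℕ) : ℤ) = i by omega]
  norm_cast

end Trinomial

/-! ### Peeling the first entry off a tuple. -/

section Tuples

theorem prod_Icc_one_succ {α : Type*} [CommMonoid α] (f : ℕ → α) (n : ℕ) :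
    ∏ k ∈ Finset.Icc 1 (n + 1), f k = f 1 * ∏ k ∈ Finset.Icc 1 n, f (k + 1) := by
  induction n with
  | zero => simp
  | succ n ih =>
    rw [Finset.prod_Icc_succ_top (by omega), ih, Finset.prod_Icc_succ_top (by omega), mul_assoc]

theorem sum_Icc_one_succ {α : Type*} [AddCommMonoid α] (f : ℕ → α) (n : ℕ) :
    ∑ k ∈ Finset.Icc 1 (n + 1), f k = f 1 + ∑ k ∈ Finset.Icc 1 n, f (k + 1) := by
  induction n with
  | zero => simp
  | succ n ih =>
    rw [Finset.sum_Icc_succ_top (by omega), ih, Finset.sum_Icc_succ_top (by omega), add_assoc]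

theorem entry_cons_one {ν : ℕ} (a : ℕ) (n : Fin ν → ℕ) :
    entry (Fin.cons a n : Fin (ν + 1) → ℕ) 1 = a := by
  rw [entry, dif_pos (by omega)]
  rfl

theorem entry_cons_succ {ν : ℕ} (a : ℕ) (n : Fin ν → ℕ) {k : ℕ} (hk : 1 ≤ k) :
    entry (Fin.cons a n : Fin (ν + 1) → ℕ) (k + 1) = entry n k := by
  obtain ⟨k, rfl⟩ : ∃ k', k = k' + 1 := ⟨k - 1, by omega⟩
  rw [entry, entry]
  by_cases h : k + 1 ≤ ν
  · rw [dif_pos (by omega), dif_pos (by omega)]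
    rfl
  · rw [dif_neg (by omega), dif_neg (by omega)]

theorem tailSum_cons_succ {ν : ℕ} (a : ℕ) (n : Fin ν → ℕ) {k : ℕ} (hk : 1 ≤ k) :
    tailSum (Fin.cons a n : Fin (ν + 1) → ℕ) (k + 1) = tailSum n k := by
  rw [tailSum, tailSum, ← Finset.map_add_right_Icc, Finset.sum_map]
  exact Finset.sum_congr rfl fun j hj =>
    entry_cons_succ a n (hk.trans (Finset.mem_Icc.mp hj).1)

theorem tailSum_cons_one {ν : ℕ} (a : ℕ) (n : Fin ν → ℕ) :
    tailSum (Fin.cons a n : Fin (ν + 1) → ℕ) 1 = a + tailSum n 1 := by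
  rw [tailSum, sum_Icc_one_succ, entry_cons_one, tailSum]
  congr 1
  exact Finset.sum_congr rfl fun j hj => entry_cons_succ a n (Finset.mem_Icc.mp hj).1

theorem tailSum_one_eq_sum {ν : ℕ} (n : Fin ν → ℕ) : tailSum n 1 = ∑ k, n k := by
  induction ν with
  | zero => rfl
  | succ ν ih =>
    rw [← Fin.cons_self_tail n, tailSum_cons_one, ih, Fin.sum_univ_succ]
    rfl

theorem entry_le_tailSum {ν : ℕ} (n : Fin ν → ℕ) {k : ℕ} (hk : 1 ≤ k) :
    entry n k ≤ tailSum n 1 := by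
  by_cases h : k ≤ ν
  · exact Finset.single_le_sum (f := entry n) (fun _ _ => Nat.zero_le _)
      (Finset.mem_Icc.mpr ⟨hk, h⟩)
  · rw [entry, dif_neg (by omega)]
    exact Nat.zero_le _

/-- The outer variable is the sum of the tail, that is N_2 when N = N_1, in order to match the
summation variable of `refinedTransform`. -/
theorem sum_antidiagonalTuple_succ {ν : ℕ} (N : ℕ) (f : (Fin (ν + 1) → ℕ) → ℂ) :
    ∑ n ∈ Finset.Nat.antidiagonalTuple (ν + 1) N, f n =
      ∑ N' ∈ Finset.range (N + 1), ∑ n ∈ Finset.Nat.antidiagonalTuple ν N',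
        f (Fin.cons (N - N') n) := by
  rw [Finset.sum_sigma']
  refine (Finset.sum_bij' (fun x _ => Fin.cons (N - x.1) x.2)
    (fun n _ => ⟨∑ k, Fin.tail n k, Fin.tail n⟩) ?_ ?_ ?_ ?_ ?_).symm
  · rintro ⟨N', n⟩ h
    simp only [Finset.mem_sigma, Finset.mem_range, Finset.Nat.mem_antidiagonalTuple] at h ⊢
    rw [Fin.sum_univ_succ]
    simp only [Fin.cons_zero, Fin.cons_succ]
    omega
  · intro n h
    rw [Finset.Nat.mem_antidiagonalTuple, Fin.sum_univ_succ] at h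
    simp only [Finset.mem_sigma, Finset.mem_range, Finset.Nat.mem_antidiagonalTuple, Fin.tail]
    exact ⟨by omega, trivial⟩
  · rintro ⟨N', n⟩ h
    simp only [Finset.mem_sigma, Finset.Nat.mem_antidiagonalTuple] at h
    simp [h.2]
  · intro n h
    rw [Finset.Nat.mem_antidiagonalTuple, Fin.sum_univ_succ] at h
    rw [show N - ∑ k, Fin.tail n k = n 0 by simp only [Fin.tail]; omega, Fin.cons_self_tail]
  · intros
    rfl

end Tuples

/-! ### The multisum as an iterated transform. -/

/-- The part of the summand of the multisum that depends on `i` and `(n_1, …, n_ν)`, after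
summation over `m`, apart from the factor at `N_1`. -/
noncomputable def chainWeight (p : ℂ) {ν : ℕ} (i : ℤ) (n : Fin ν → ℕ) : ℂ :=
  (p ^ 3) ^ (∑ k ∈ Finset.Icc 1 ν, tailSum n k ^ 2) *
    (∏ j ∈ Finset.Icc 1 (ν - 1), qBinom ((p ^ 3) ^ 2)
      (i - (∑ k ∈ Finset.Icc 1 j, (tailSum n k : ℤ)) + entry n j) (entry n j)) *
    innerSum p (i - ∑ k ∈ Finset.Icc 1 ν, (tailSum n k : ℤ)) (entry n ν)

section Chain

theorem chainWeight_cons (p : ℂ) {ν : ℕ} (hν : 1 ≤ ν) (i : ℤ) (a : ℕ) (n : Fin ν → ℕ) :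
    chainWeight p i (Fin.cons a n : Fin (ν + 1) → ℕ) =
      (p ^ 3) ^ ((a + tailSum n 1) ^ 2) *
        qBinom ((p ^ 3) ^ 2) (i - (a + tailSum n 1 : ℕ) + a) a *
        chainWeight p (i - (a + tailSum n 1 : ℕ)) n := by
  have h {α : Type} [AddCommMonoid α] (f : ℕ → α) (j : ℕ) :
      ∑ k ∈ Finset.Icc 1 (j + 1), f (tailSum (Fin.cons a n : Fin (ν + 1) → ℕ) k) =
        f (a + tailSum n 1) + ∑ k ∈ Finset.Icc 1 j, f (tailSum n k) := by
    rw [sum_Icc_one_succ, tailSum_cons_one]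
    congr 1
    exact Finset.sum_congr rfl fun k hk => by
      rw [tailSum_cons_succ a n (Finset.mem_Icc.mp hk).1]
  obtain ⟨ν, rfl⟩ : ∃ ν', ν = ν' + 1 := ⟨ν - 1, by omega⟩
  rw [chainWeight, chainWeight, h fun t => t ^ 2, h fun t => (t : ℤ), add_tsub_cancel_right,
    prod_Icc_one_succ, add_tsub_cancel_right, entry_cons_one, entry_cons_succ a n hν,
    Finset.Icc_self, Finset.sum_singleton, tailSum_cons_one, ← sub_sub, pow_add]
  have h' : ∏ k ∈ Finset.Icc 1 ν, qBinom ((p ^ 3) ^ 2)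
      (i - (∑ t ∈ Finset.Icc 1 (k + 1), (tailSum (Fin.cons a n : Fin (ν + 1 + 1) → ℕ) t : ℤ)) +
        entry (Fin.cons a n : Fin (ν + 1 + 1) → ℕ) (k + 1))
      (entry (Fin.cons a n : Fin (ν + 1 + 1) → ℕ) (k + 1)) =
      ∏ k ∈ Finset.Icc 1 ν, qBinom ((p ^ 3) ^ 2)
        (i - (a + tailSum n 1 : ℕ) - (∑ t ∈ Finset.Icc 1 k, (tailSum n t : ℤ)) + entry n k)
        (entry n k) := by
    refine Finset.prod_congr rfl fun k hk => ?_
    rw [h fun t => (t : ℤ), entry_cons_succ a n (Finset.mem_Icc.mp hk).1, ← sub_sub]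
  rw [h']
  ring

/-- Induction by peeling n_1 = N - N'. By symmetry [i-N+n_1, n_1] = [i-N+N-N', i-N], which is the
kernel of the transform at (i-N, N); what remains is the same sum for i - N and the tail. -/
theorem sum_chainWeight (p : ℂ) (ν N : ℕ) (i : ℤ) :
    ∑ n ∈ Finset.Nat.antidiagonalTuple (ν + 1) N, chainWeight p i n =
      (p ^ 3) ^ (N ^ 2) * (refinedTransform (p ^ 3))^[ν] (innerSum p) (i - N) N := by
  induction ν generalizing N i with
  | zero =>
    simp [Finset.Nat.antidiagonalTuple_one, chainWeight, tailSum, entry]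
  | succ ν ih =>
    rw [sum_antidiagonalTuple_succ, Function.iterate_succ_apply', refinedTransform, Finset.mul_sum]
    refine Finset.sum_congr rfl fun N' hN' => ?_
    have hN := Finset.mem_range.mp hN'
    rw [mul_assoc ((p ^ 3) ^ (N' ^ 2)), mul_left_comm ((p ^ 3) ^ (N' ^ 2)), ← ih, Finset.mul_sum,
      Finset.mul_sum]
    refine Finset.sum_congr rfl fun n hn => ?_
    rw [Finset.Nat.mem_antidiagonalTuple, ← tailSum_one_eq_sum] at hn
    rw [chainWeight_cons p (by omega), hn, Nat.sub_add_cancel (by omega),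
      qBinom_symm _ (i - N + N - N'), show i - (N : ℤ) + N - N' - (i - N) = (N - N' : ℕ) by omega,
      show i - (N : ℤ) + N - N' = i - N + (N - N' : ℕ) by omega]
    ring

/-- The parity condition is the evenness built into `evenBinom`, so the restricted sum over m is
`innerSum`. -/
theorem sum_multisumTerm {p : ℂ} (L : ℕ) {ν : ℕ} (i : ℕ) (n : Fin ν → ℕ) {B : ℕ}
    (hB : 3 * entry n ν ≤ B) :
    ∑ m ∈ Finset.range (B + 1), (multisumIndex ν).indicator
        (fun x => multisumTerm (p ^ 2) L ν x.1 x.2.1 x.2.2) (i, m, n) =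
      (p ^ 3) ^ (i ^ 2) * qBinom ((p ^ 3) ^ 2) (L - tailSum n 1) i * chainWeight p i n := by
  rw [← Finset.sum_subset (Finset.range_mono (Nat.succ_le_succ hB)), chainWeight, innerSum,
    qBinomSum, Finset.mul_sum, Finset.mul_sum]
  · refine Finset.sum_congr rfl fun m _ => ?_
    have hpar : Even ((i : ℤ) - (∑ k ∈ Finset.Icc 1 ν, (tailSum n k : ℤ)) - m) ↔
        (i, m, n) ∈ multisumIndex ν := by
      have hmem : (i, m, n) ∈ multisumIndex ν ↔
        (i + m) % 2 = (∑ k ∈ Finset.Icc 1 ν, tailSum n k) % 2 := Iff.rfl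
      rw [hmem, Int.even_iff]
      have : (∑ k ∈ Finset.Icc 1 ν, (tailSum n k : ℤ)) =
        ((∑ k ∈ Finset.Icc 1 ν, tailSum n k : ℕ) : ℤ) := by push_cast; rfl
      omega
    by_cases h : (i, m, n) ∈ multisumIndex ν
    · rw [Set.indicator_of_mem h, multisumTerm, evenBinom, if_pos (hpar.mpr h)]
      -- A square has the parity of its base, so the parity condition makes the numerator even and
      -- the division by 2 exact.
      have hpow : (p ^ 2) ^ ((m ^ 2 + 3 * (i ^ 2 + ∑ k ∈ Finset.Icc 1 ν, tailSum n k ^ 2)) / 2) =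
          p ^ (m ^ 2) * (p ^ 3) ^ (i ^ 2) *
            (p ^ 3) ^ (∑ k ∈ Finset.Icc 1 ν, tailSum n k ^ 2) := by
        have hsq : (∑ k ∈ Finset.Icc 1 ν, tailSum n k ^ 2) % 2 =
            (∑ k ∈ Finset.Icc 1 ν, tailSum n k) % 2 := by
          rw [Finset.sum_nat_mod, Finset.sum_nat_mod _ _ (fun k => tailSum n k)]
          congr 1
          refine Finset.sum_congr rfl fun k _ => ?_
          rcases Nat.mod_two_eq_zero_or_one (tailSum n k) with h | h <;> simp [Nat.pow_mod, h]
        have hm : m ^ 2 % 2 = m % 2 := by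
          rcases Nat.mod_two_eq_zero_or_one m with h | h <;> simp [Nat.pow_mod, h]
        have hi : i ^ 2 % 2 = i % 2 := by
          rcases Nat.mod_two_eq_zero_or_one i with h | h <;> simp [Nat.pow_mod, h]
        have h' : (i + m) % 2 = (∑ k ∈ Finset.Icc 1 ν, tailSum n k) % 2 := h
        rw [← pow_mul, Nat.mul_div_cancel' (by omega), ← pow_mul, ← pow_mul, ← pow_add, ← pow_add]
        congr 1
        ring
      rw [hpow, show (p ^ 2) ^ 3 = (p ^ 3) ^ 2 by ring]
      push_cast
      ring
    · rw [Set.indicator_of_notMem h, evenBinom, if_neg (fun h' => h (hpar.mp h'))]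
      ring
  · intro m _ hm
    rw [Finset.mem_range, not_lt] at hm
    refine (Set.indicator_apply_eq_zero).mpr fun _ => ?_
    simp only [multisumTerm]
    rw [qBinom_of_lt (p ^ 2) (by omega : 3 * (entry n ν : ℤ) < m)]
    ring

theorem multisumTerm_eq_zero (q : ℂ) {L ν i m : ℕ} (hν : 1 ≤ ν) {n : Fin ν → ℕ}
    (h : ¬ (i ≤ L ∧ m ≤ 3 * L ∧ tailSum n 1 ≤ L)) : multisumTerm q L ν i m n = 0 := by
  rw [multisumTerm]
  by_cases h1 : i + tailSum n 1 ≤ L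
  · have := entry_le_tailSum n hν
    rw [qBinom_of_lt q (by omega : 3 * (entry n ν : ℤ) < m)]
    ring
  · rw [qBinom_of_lt (q ^ 3) (by omega : (L : ℤ) - tailSum n 1 < i)]
    ring

/-- A finite set of indices outside of which the summand of the multisum vanishes. -/
def multisumBox (L ν : ℕ) : Finset (ℕ × ℕ × (Fin ν → ℕ)) :=
  Finset.range (L + 1) ×ˢ Finset.range (3 * L + 1) ×ˢ
    (Finset.range (L + 1)).biUnion (Finset.Nat.antidiagonalTuple ν)

theorem hasSum_multisumTerm (q : ℂ) (L : ℕ) {ν : ℕ} (hν : 1 ≤ ν) :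
    HasSum (fun x : multisumIndex ν => multisumTerm q L ν x.1.1 x.1.2.1 x.1.2.2)
      (∑ x ∈ multisumBox L ν, (multisumIndex ν).indicator
        (fun x => multisumTerm q L ν x.1 x.2.1 x.2.2) x) := by
  have : HasSum ((multisumIndex ν).indicator fun x => multisumTerm q L ν x.1 x.2.1 x.2.2)
      (∑ x ∈ multisumBox L ν, (multisumIndex ν).indicator
        (fun x => multisumTerm q L ν x.1 x.2.1 x.2.2) x) := by
    refine hasSum_sum_of_ne_finset_zero ?_
    rintro ⟨i, m, n⟩ h
    refine Set.indicator_apply_eq_zero.mpr fun _ => multisumTerm_eq_zero q hν fun h' => h ?_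
    obtain ⟨h1, h2, h3⟩ : i ≤ L ∧ m ≤ 3 * L ∧ tailSum n 1 ≤ L := h'
    simp only [multisumBox, Finset.mem_product, Finset.mem_range, Finset.mem_biUnion,
      Finset.Nat.mem_antidiagonalTuple]
    exact ⟨by omega, by omega, tailSum n 1, by omega, (tailSum_one_eq_sum n).symm⟩
  exact (hasSum_subtype_iff_indicator
    (f := fun x : ℕ × ℕ × (Fin ν → ℕ) => multisumTerm q L ν x.1 x.2.1 x.2.2)).mpr this

/-- The factor [L - N_1, i] is the kernel of the transform at (i, L - i), so summing over N_1
supplies the last of the ν iterations. -/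
theorem sum_multisumBox {p : ℂ} (L : ℕ) {ν : ℕ} (hν : 1 ≤ ν) :
    ∑ x ∈ multisumBox L ν, (multisumIndex ν).indicator
        (fun x => multisumTerm (p ^ 2) L ν x.1 x.2.1 x.2.2) x =
      ∑ i ∈ Finset.range (L + 1),
        (p ^ 3) ^ (i ^ 2) * (refinedTransform (p ^ 3))^[ν] (innerSum p) i (L - i) := by
  obtain ⟨ν, rfl⟩ : ∃ ν', ν = ν' + 1 := ⟨ν - 1, by omega⟩
  rw [multisumBox, Finset.sum_product]
  refine Finset.sum_congr rfl fun i hi => ?_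
  have hi' := Finset.mem_range.mp hi
  rw [Finset.sum_product, Finset.sum_comm, Finset.sum_biUnion]
  · have h (N : ℕ) (hN : N ∈ Finset.range (L + 1)) :
        ∑ n ∈ Finset.Nat.antidiagonalTuple (ν + 1) N, ∑ m ∈ Finset.range (3 * L + 1),
          (multisumIndex (ν + 1)).indicator
            (fun x => multisumTerm (p ^ 2) L (ν + 1) x.1 x.2.1 x.2.2) (i, m, n) =
        (p ^ 3) ^ (i ^ 2) * ((p ^ 3) ^ (N ^ 2) * qBinom ((p ^ 3) ^ 2) (L - N) i *
          (refinedTransform (p ^ 3))^[ν] (innerSum p) (i - N) N) := by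
      rw [mul_right_comm ((p ^ 3) ^ (N ^ 2)), ← sum_chainWeight, Finset.sum_mul, Finset.mul_sum]
      refine Finset.sum_congr rfl fun n hn => ?_
      rw [Finset.Nat.mem_antidiagonalTuple, ← tailSum_one_eq_sum] at hn
      have := entry_le_tailSum n hν
      have := Finset.mem_range.mp hN
      rw [sum_multisumTerm L i n (by omega), hn]
      ring
    rw [Finset.sum_congr rfl h, ← Finset.mul_sum, Function.iterate_succ_apply', refinedTransform]
    congr 1
    rw [← Finset.sum_subset (Finset.range_mono (by omega : L - i + 1 ≤ L + 1))]
    · refine Finset.sum_congr rfl fun N _ => ?_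
      rw [show (i : ℤ) + (L - i : ℕ) - N = L - N by omega]
    · intro N _ hN
      rw [Finset.mem_range, not_lt] at hN
      rw [qBinom_of_lt _ (by omega : (L : ℤ) - N < i)]
      ring
  · intro N _ N' _ hne
    rw [Function.onFun, Finset.disjoint_left]
    intro n hn hn'
    rw [Finset.Nat.mem_antidiagonalTuple] at hn hn'
    exact hne (hn.symm.trans hn')

/-- The value q = 0 is separate because the exponent laws for integer powers need a nonzero base.
Only the index with exponent 0 contributes. -/
theorem tsum_multisumTerm_zero (L : ℕ) {ν : ℕ} (hν : 1 ≤ ν) :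
    ∑' x : multisumIndex ν, multisumTerm 0 L ν x.1.1 x.1.2.1 x.1.2.2 = 1 := by
  have h0 : ‖(0 : ℂ)‖ < 1 := by simp
  have hz (k : ℕ) : entry (0 : Fin ν → ℕ) k = 0 := by rw [entry]; split_ifs <;> rfl
  have hz' (k : ℕ) : tailSum (0 : Fin ν → ℕ) k = 0 := Finset.sum_eq_zero fun j _ => hz j
  have hmem : ((0, 0, 0) : ℕ × ℕ × (Fin ν → ℕ)) ∈ multisumIndex ν := by
    simp [multisumIndex, hz', Nat.ModEq]
  rw [tsum_eq_single ⟨(0, 0, 0), hmem⟩]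
  · simp [multisumTerm, hz, hz', qBinom_zero_right h0]
  · rintro ⟨⟨i, m, n⟩, hx⟩ hne
    simp only [multisumTerm]
    rw [zero_pow]
    · ring
    intro hexp
    apply hne
    have hS := Finset.single_le_sum (f := fun k => tailSum n k ^ 2) (fun _ _ => Nat.zero_le _)
      (Finset.mem_Icc.mpr ⟨le_rfl, hν⟩)
    have hi : i = 0 := by
      by_contra h; have := pow_pos (Nat.pos_of_ne_zero h) 2; omega
    have hN : tailSum n 1 = 0 := by
      by_contra h; have := pow_pos (Nat.pos_of_ne_zero h) 2; omega
    have hn : n = 0 := by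
      rw [tailSum_one_eq_sum, Finset.sum_eq_zero_iff] at hN
      exact funext fun k => hN k (Finset.mem_univ k)
    subst hi hn
    -- The index m = 1 would also give exponent 0, since 1 / 2 rounds down; parity rules it out.
    have hm' : (0 + m) % 2 = 0 % 2 := by simpa [multisumIndex, hz', Nat.ModEq] using hx
    have hm : m = 0 := by
      by_contra h
      have : 2 * 2 ≤ m * m := Nat.mul_le_mul (by omega) (by omega)
      rw [sq m] at hexp
      omega
    subst hm
    rfl

theorem tsum_trinomialTerm_zero (L ν : ℕ) : ∑' j : ℤ, trinomialTerm 0 L ν j = 1 := by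
  rw [tsum_eq_single 0]
  · rw [trinomialTerm, mul_zero, roundTrinomial_self, trinomialSum,
      Finset.sum_eq_single_of_mem 0 (by simp)]
    · have := qPoch_self_ne_zero (q := (0 : ℂ) ^ 3) (by simp) L
      simp [qPochRecip] at this ⊢
      simp [qPoch] at this ⊢
    · intro n _ hn
      have : (n : ℤ) * (n + 0) ≠ 0 := by simpa using hn
      rw [zero_pow three_ne_zero, zero_zpow _ this, zero_mul]
  · intro j hj
    rw [trinomialTerm, zero_zpow, zero_mul]
    intro h
    have h1 : j * (3 * (((ν + 2).choose 2 : ℤ) * j) + 1) = 0 := by linear_combination h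
    rcases mul_eq_zero.mp h1 with h | h
    · exact hj h
    -- The remaining factor is 1 modulo 3, hence nonzero.
    · omega

end Chain

theorem mainTheorem9 (ν : ℕ) (hν : 1 ≤ ν) (L : ℕ) (q : ℂ) (hq : ‖q‖ < 1) :
    Summable (fun x : multisumIndex ν => multisumTerm q L ν x.1.1 x.1.2.1 x.1.2.2) ∧
    Summable (fun j : ℤ => trinomialTerm q L ν j) ∧
    ∑' x : multisumIndex ν, multisumTerm q L ν x.1.1 x.1.2.1 x.1.2.2 =
      ∑' j : ℤ, trinomialTerm q L ν j := by
  refine ⟨(hasSum_multisumTerm q L hν).summable, (hasSum_trinomialTerm q L ν).summable, ?_⟩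
  rcases eq_or_ne q 0 with rfl | hq0
  · rw [tsum_multisumTerm_zero L hν, tsum_trinomialTerm_zero]
  · obtain ⟨p, rfl⟩ := IsAlgClosed.exists_pow_nat_eq q two_pos
    have hp0 : p ≠ 0 := fun h => hq0 (by rw [h, zero_pow two_ne_zero])
    have hp : ‖p‖ < 1 := by
      rw [norm_pow] at hq
      exact (pow_lt_one_iff_of_nonneg (norm_nonneg p) two_ne_zero).mp hq
    rw [(hasSum_multisumTerm (p ^ 2) L hν).tsum_eq, (hasSum_trinomialTerm (p ^ 2) L ν).tsum_eq,
      sum_multisumBox L hν, sum_trinomialTerm hp0 hp]
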